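/- Let $K$ be an algebraically closed field. For $n\ge 0$ let $T_n$ (resp. $U_n$) be the vector space of upper triangular (resp. strictly upper triangular) $n\times n$ matrices over $K$, and let $$CT_n=\{(X,Y)\in T_n\times T_n : XY=YX\},\qquad NT_n=\{(X,Y)\in U_n\times U_n : XY=YX\},$$ regarded as Zariski closed subsets of the affine spaces $T_n\times T_n$ and $U_n\times U_n$ respectively. Call a closed subset $V$ of an affine space $\mathbb{A}^N$ a set-theoretic complete intersection if it is the zero set of $N-\dim V$ polynomials, and an ideal-theoretic complete intersection if its vanishing ideal is generated by $N-\dim V$ polynomials. In what follows, "complete intersection" may be read in either of these two senses (the same one throughout). (1) For every $n\ge 1$: if $CT_{n-1}$ is reducible, then $CT_n$ is reducible; if $CT_{n-1}$ is not a complete intersection, then $CT_n$ is not a complete intersection. The same holds with $NT$ in place of $CT$. (2) There are natural numbers $m,m'$ such that, for all $n\ge 0$, $CT_n$ is not a complete intersection if and only if $n>m$, and $CT_n$ is reducible if and only if $n>m'$. (3) There are likewise natural numbers (possibly different from those in (2)) with the same properties for $NT_n$ in place of $CT_n$. -/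

import Mathlib

noncomputable section

namespace CommutingTriangular

open MvPolynomial

/-! Affine varieties in the affine space `σ → K`. -/

/-- The set of common zeros in `σ → K` of a finite family of polynomials. -/
def commonZeros {K σ : Type*} [Field K] {c : ℕ} (f : Fin c → MvPolynomial σ K) : Set (σ → K) :=
  {x | ∀ i, eval x (f i) = 0}

/-- `V` is irreducible for the Zariski topology of `σ → K`: it is nonempty, and it is not covered
by two Zariski closed sets neither of which contains it. -/
def ZariskiIrreducible {K σ : Type*} [Field K] (V : Set (σ → K)) : Prop :=
  V.Nonempty ∧ ∀ I J : Ideal (MvPolynomial σ K),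
    V ⊆ zeroLocus K I ∪ zeroLocus K J → V ⊆ zeroLocus K I ∨ V ⊆ zeroLocus K J

/-- The dimension of `V`: the Krull dimension of its coordinate ring
(`⊥` if `V` is empty). -/
def affineDim {K σ : Type*} [Field K] (V : Set (σ → K)) : WithBot ℕ∞ :=
  ringKrullDim (MvPolynomial σ K ⧸ vanishingIdeal K V)

/-- `V` is a set-theoretic complete intersection in `σ → K`:
it is the zero set of as many polynomials as its codimension. -/
def IsSetCompleteIntersection {K σ : Type*} [Field K] [Fintype σ] (V : Set (σ → K)) : Prop :=
  ∃ (c : ℕ) (f : Fin c → MvPolynomial σ K),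
    V = commonZeros f ∧ affineDim V + (c : WithBot ℕ∞) = (Fintype.card σ : WithBot ℕ∞)

/-- `V` is an ideal-theoretic (strict) complete intersection in `σ → K`:
it is closed and its ideal is generated by as many polynomials as its codimension. -/
def IsIdealCompleteIntersection {K σ : Type*} [Field K] [Fintype σ] (V : Set (σ → K)) : Prop :=
  ∃ (c : ℕ) (f : Fin c → MvPolynomial σ K),
    V = commonZeros f ∧ vanishingIdeal K V = Ideal.span (Set.range f) ∧
      affineDim V + (c : WithBot ℕ∞) = (Fintype.card σ : WithBot ℕ∞)

/-! Pairs of commuting triangular matrices. -/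

/-- The positions on or above the diagonal: the coordinates of the space of
upper triangular matrices. -/
abbrev UpperIdx (n : ℕ) : Type := {p : Fin n × Fin n // p.1 ≤ p.2}

/-- The positions above the diagonal: the coordinates of the space of
strictly upper triangular matrices. -/
abbrev StrictIdx (n : ℕ) : Type := {p : Fin n × Fin n // p.1 < p.2}

/-- The upper triangular matrix with the given entries on and above the diagonal. -/
def upperMatrix {K : Type*} [Field K] {n : ℕ} (a : UpperIdx n → K) :
    Matrix (Fin n) (Fin n) K :=
  Matrix.of fun i j => if h : i ≤ j then a ⟨(i, j), h⟩ else 0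

/-- The strictly upper triangular matrix with the given entries above the diagonal. -/
def strictMatrix {K : Type*} [Field K] {n : ℕ} (a : StrictIdx n → K) :
    Matrix (Fin n) (Fin n) K :=
  Matrix.of fun i j => if h : i < j then a ⟨(i, j), h⟩ else 0

/-- Pairs of commuting upper triangular `n × n` matrices, a subset of the affine space of all pairs
of upper triangular matrices (`Sum.inl` for the entries of the first matrix, `Sum.inr` for those of
the second one). -/
def CT (K : Type*) [Field K] (n : ℕ) : Set (UpperIdx n ⊕ UpperIdx n → K) :=
  {p | Commute (upperMatrix fun e => p (Sum.inl e)) (upperMatrix fun e => p (Sum.inr e))}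

/-- Pairs of commuting strictly upper triangular `n × n` matrices, a subset of the affine space of
all pairs of strictly upper triangular matrices. -/
def NT (K : Type*) [Field K] (n : ℕ) : Set (StrictIdx n ⊕ StrictIdx n → K) :=
  {p | Commute (strictMatrix fun e => p (Sum.inl e)) (strictMatrix fun e => p (Sum.inr e))}

end CommutingTriangular

end

open CommutingTriangular

/-!
Both families are treated as instances of one situation. For a relation `R` on the indices, the
pairs of commuting matrices supported on `R` are the zeros of the commutator entries that are not
identically zero. These are linearly independent quadratic forms, and the *expected dimension* `d`
is the number of coordinates minus the number of these forms.

* Let `X₀` be a regular matrix: diagonal with distinct entries, respectively a nilpotent Jordan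
  block. A matrix `Y` commuting with `X₀` is determined by its diagonal, respectively by its first
  row. Hence `d` further equations cut the variety down to the single point `(X₀, 0)`. By Krull's
  height theorem the variety cannot be cut out by fewer polynomials than there are quadratic forms,
  so it is a set-theoretic complete intersection if and only if its dimension is at most `d`
  (`IsConeSystem.isSetCompleteIntersection_iff`).
* If the vanishing ideal is generated by as many polynomials as there are quadratic forms, then by
  a graded Nakayama argument it is generated by the forms themselves, since the variety contains
  all coordinate axes and its ideal therefore has no elements of order less than two. So the
  variety is an ideal-theoretic complete intersection if and only if its dimension is at most `d`
  and its ideal is generated by the commutator entries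
  (`IsConeSystem.isIdealCompleteIntersection_iff`).
* Deleting the last row and column maps the variety of size `n + 1` onto that of size `n`, with a
  section given by padding with zeros. This transfers irreducibility, and it transfers the equality
  of ideals because the old coordinate ring is a retract of the new one. The new equations vanish on
  the image of the section, so by Krull's height theorem the dimension grows at least as much as `d`
  does (`IsExtension.step`).
* At a generic point of an irreducible variety of this kind the first matrix is regular, so the
  commutation relations express all coordinates rationally in `d` of them. As the dimension of a
  finitely generated domain is bounded by its transcendence degree, the dimension is at most `d`
  (`ZariskiIrreducible.affineDim_le`).
* For size 28 the block strictly upper triangular commuting pairs with blocks of sizes 8, 12, 8 have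
  dimension greater than `d`; so all three properties fail there. They hold for `n = 0`, and since
  each of them passes from `n` to `n - 1`, the thresholds exist.
-/

namespace CommutingTriangular

open MvPolynomial

/-! ### Dimension theory of polynomial rings -/

/-- Maximal ideals of a polynomial ring over a Jacobson ring contract to maximal ideals, so the
one-variable formula for the height can be iterated. -/
theorem height_eq_height_comap_C_add_card {B τ : Type*} [CommRing B] [IsNoetherianRing B]
    [IsJacobsonRing B] [Finite τ] (M : Ideal (MvPolynomial τ B)) [M.IsMaximal] :
    M.height = (M.comap C).height + Nat.card τ := by
  induction τ using Finite.induction_empty_option with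
  | of_equiv e ih =>
    have : (M.comap (renameEquiv B e).toRingEquiv).IsMaximal :=
      Ideal.comap_isMaximal_of_surjective _ (renameEquiv B e).surjective
    have h := ih (M.comap (renameEquiv B e).toRingEquiv)
    have hC : (M.comap (renameEquiv B e).toRingEquiv).comap C = M.comap C := by
      ext; simp [Ideal.mem_comap]
    rwa [RingEquiv.height_comap, Nat.card_congr e, hC] at h
  | h_empty =>
    have hC : M.comap C = M.comap (isEmptyAlgEquiv B PEmpty).symm.toRingEquiv := by
      ext x
      simp only [Ideal.mem_comap]
      exact iff_of_eq (congrArg (· ∈ M) ((isEmptyAlgEquiv B PEmpty).injective (by simp)))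
    rw [hC, RingEquiv.height_comap]
    simp
  | @h_option τ _ ih =>
    set e := (optionEquivLeft B τ).symm.toRingEquiv
    have : (M.comap e).IsMaximal := Ideal.comap_isMaximal_of_surjective _ e.surjective
    have := Polynomial.isMaximal_comap_C_of_isJacobsonRing (M.comap e)
    have : (M.comap e).LiesOver ((M.comap e).comap Polynomial.C) := ⟨rfl⟩
    have hC : ((M.comap e).comap Polynomial.C).comap C = M.comap C := by
      ext x
      simp [Ideal.mem_comap, e, optionEquivLeft_symm_C_C]
    rw [← RingEquiv.height_comap e,
      Polynomial.height_eq_height_add_one ((M.comap e).comap Polynomial.C), ih, hC,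
      Finite.card_option, add_assoc]
    norm_cast

theorem height_vanishingIdeal_singleton {K σ : Type*} [Field K] [Finite σ] (v : σ → K) :
    (vanishingIdeal K {v}).height = Nat.card σ := by
  have h : (vanishingIdeal K {v}).comap (C : K →+* MvPolynomial σ K) = ⊥ := by
    ext; simp
  rw [height_eq_height_comap_C_add_card, h, Ideal.height_bot, zero_add]

theorem ringKrullDim_quotient_radical {A : Type*} [CommRing A] (I : Ideal A) :
    ringKrullDim (A ⧸ I.radical) = ringKrullDim (A ⧸ I) := by
  rw [ringKrullDim_quotient, ringKrullDim_quotient, PrimeSpectrum.zeroLocus_radical]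

theorem ringKrullDim_quotient_anti {A : Type*} [CommRing A] {I J : Ideal A} (h : I ≤ J) :
    ringKrullDim (A ⧸ J) ≤ ringKrullDim (A ⧸ I) :=
  ringKrullDim_le_of_surjective (Ideal.Quotient.factor h) (Ideal.Quotient.factor_surjective h)

section
variable {K σ : Type*} [Field K]

theorem affineDim_mono {V W : Set (σ → K)} (h : V ⊆ W) : affineDim V ≤ affineDim W :=
  ringKrullDim_quotient_anti (vanishingIdeal_anti_mono h)

theorem affineDim_le_card [Fintype σ] (V : Set (σ → K)) :
    affineDim V ≤ (Fintype.card σ : WithBot ℕ∞) := by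
  refine (ringKrullDim_quotient_le _).trans ?_
  rw [MvPolynomial.ringKrullDim_of_isNoetherianRing, ringKrullDim_eq_zero_of_field, zero_add,
    Nat.card_eq_fintype_card]

theorem exists_affineDim_eq [Fintype σ] {V : Set (σ → K)} (hV : V.Nonempty) :
    ∃ k : ℕ, affineDim V = (k : WithBot ℕ∞) := by
  obtain ⟨v, hv⟩ := hV
  have : Nontrivial (MvPolynomial σ K ⧸ vanishingIdeal K V) := by
    rw [Ideal.Quotient.nontrivial_iff, Ne, Ideal.eq_top_iff_one]
    intro h
    simpa using h v hv
  have h0 : 0 ≤ affineDim V := ringKrullDim_nonneg_of_nontrivial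
  have h1 := affineDim_le_card V
  revert h0 h1
  generalize affineDim V = x
  intro h0 h1
  induction x with
  | bot => simp at h0
  | coe x =>
    induction x using ENat.recTopCoe with
    | top =>
      have : (⊤ : ℕ∞) ≤ (Fintype.card σ : ℕ∞) := by exact_mod_cast h1
      simp at this
    | coe k => exact ⟨k, rfl⟩

variable [IsAlgClosed K] [Fintype σ]

theorem affineDim_zeroLocus (I : Ideal (MvPolynomial σ K)) :
    affineDim (zeroLocus K I) = ringKrullDim (MvPolynomial σ K ⧸ I) := by
  rw [affineDim, vanishingIdeal_zeroLocus_eq_radical, ringKrullDim_quotient_radical]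

/-- Krull's height theorem at the point `v`: a set containing the nonempty zero set of finitely
many polynomials has codimension at most their number. -/
theorem card_le_affineDim_add_card {E : Type*} [Fintype E] (q : E → MvPolynomial σ K)
    {V : Set (σ → K)} (hV : ∀ x, (∀ p, eval x (q p) = 0) → x ∈ V) (v : σ → K)
    (hv : ∀ p, eval v (q p) = 0) :
    (Fintype.card σ : WithBot ℕ∞) ≤ affineDim V + (Fintype.card E : WithBot ℕ∞) := by
  have hsub : Set.range q ⊆ vanishingIdeal K {v} := by
    rintro _ ⟨p, rfl⟩
    simp [aeval_eq_eval, hv]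
  have h := Ideal.height_le_ringKrullDim_quotient_add_encard (p := vanishingIdeal K {v})
    (Set.range q) hsub
  rw [height_vanishingIdeal_singleton, Nat.card_eq_fintype_card] at h
  have h1 : ringKrullDim (MvPolynomial σ K ⧸ Ideal.span (Set.range q)) ≤ affineDim V := by
    rw [← affineDim_zeroLocus]
    refine affineDim_mono fun x hx => hV x fun p => ?_
    simpa [aeval_eq_eval] using hx (q p) (Ideal.subset_span ⟨p, rfl⟩)
  have h2 : (Set.range q).encard ≤ (Fintype.card E : ℕ∞) := by
    rw [← Set.image_univ]
    refine (Set.encard_image_le _ _).trans ?_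
    simp [Set.encard_univ]
  refine h.trans (add_le_add h1 ?_)
  exact_mod_cast h2

/-- Krull's height theorem: a single point cannot be cut out by fewer polynomials than there are
coordinates. -/
theorem card_le_card_of_forall_eq {E : Type*} [Fintype E] (q : E → MvPolynomial σ K)
    (v : σ → K) (hv : ∀ x, (∀ p, eval x (q p) = 0) ↔ x = v) :
    Fintype.card σ ≤ Fintype.card E := by
  have hZ : zeroLocus K (Ideal.span (Set.range q)) = {v} := by
    rw [zeroLocus_span]
    ext x; simp [aeval_eq_eval, ← hv]
  have hmin : vanishingIdeal K {v} ∈ (Ideal.span (Set.range q)).minimalPrimes := by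
    rw [← hZ, vanishingIdeal_zeroLocus_eq_radical, ← Ideal.radical_minimalPrimes,
      ← vanishingIdeal_zeroLocus_eq_radical (K := K), hZ]
    simp [Ideal.minimalPrimes_eq_subsingleton_self]
  have h := Ideal.height_le_card_of_mem_minimalPrimes_span (Set.finite_range q) hmin
  rw [height_vanishingIdeal_singleton, Nat.card_eq_fintype_card] at h
  have h' : Fintype.card σ ≤ (Set.range q).ncard := by exact_mod_cast h
  refine h'.trans ?_
  rw [← Nat.card_coe_set_eq, ← Nat.card_eq_fintype_card]
  exact Finite.card_range_le q

/-- Adjoin variables to `B` and impose equations without constant term. The maximal ideal generated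
by the variables and a maximal ideal of `B` of maximal height contains all these equations, so
Krull's height theorem bounds the loss of dimension. The quotient is taken on the side of a ring
`S` that maps onto the polynomial ring. -/
theorem ringKrullDim_add_card_le {B S τ E : Type*} [CommRing B] [IsNoetherianRing B]
    [IsJacobsonRing B] [FiniteRingKrullDim B] [CommRing S] [Finite τ] [Fintype E]
    (Ψ : S →+* MvPolynomial τ B) (hΨ : Function.Surjective Ψ) (q : E → S)
    (hq : ∀ p, constantCoeff (Ψ (q p)) = 0) :
    ringKrullDim B + (Nat.card τ : WithBot ℕ∞) ≤
      ringKrullDim (S ⧸ (Ideal.span (Set.range (Ψ ∘ q))).comap Ψ) +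
        (Fintype.card E : WithBot ℕ∞) := by
  obtain ⟨m, hm, hmh⟩ := Ideal.exists_isMaximal_height (R := B)
  let M : Ideal (MvPolynomial τ B) := m.comap (constantCoeff (σ := τ) (R := B))
  have : M.IsMaximal := Ideal.comap_isMaximal_of_surjective _
    (fun b => ⟨C b, constantCoeff_C _ b⟩)
  have hMC : M.comap C = m := by
    ext; simp [M]
  have hMh := height_eq_height_comap_C_add_card M
  rw [hMC] at hMh
  have hqM : Set.range (Ψ ∘ q) ⊆ M := by
    rintro _ ⟨p, rfl⟩
    simp [M, hq]
  have h := Ideal.height_le_ringKrullDim_quotient_add_encard (p := M) (Set.range (Ψ ∘ q)) hqM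
  have h1 : ringKrullDim (MvPolynomial τ B ⧸ Ideal.span (Set.range (Ψ ∘ q))) ≤
      ringKrullDim (S ⧸ (Ideal.span (Set.range (Ψ ∘ q))).comap Ψ) :=
    ringKrullDim_le_of_surjective (Ideal.quotientMap _ Ψ le_rfl) (Ideal.quotientMap_surjective hΨ)
  have h2 : (Set.range (Ψ ∘ q)).encard ≤ (Fintype.card E : ℕ∞) := by
    rw [← Set.image_univ]
    refine (Set.encard_image_le _ _).trans ?_
    simp [Set.encard_univ]
  rw [← hmh]
  rw [hMh] at h
  refine h.trans (add_le_add h1 ?_)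
  exact_mod_cast h2

/-- If `V` contains the zeros lying over `V'` of equations that vanish on `V' × 0`, then its
dimension exceeds that of `V'` by at least the number of new coordinates minus the number of
equations. -/
theorem affineDim_add_card_le {σ' E : Type*} [Fintype σ'] [Fintype E] (ι : σ' ↪ σ)
    {V' : Set (σ' → K)} {V : Set (σ → K)} (hV' : zeroLocus K (vanishingIdeal K V') ⊆ V')
    (hne : V'.Nonempty) (q : E → MvPolynomial σ K)
    (hV : ∀ x, x ∘ ι ∈ V' → (∀ p, eval x (q p) = 0) → x ∈ V)
    (hq : ∀ p, ∀ x, x ∘ ι ∈ V' → (∀ s ∉ Set.range ι, x s = 0) → eval x (q p) = 0) :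
    affineDim V' + (Fintype.card σ : WithBot ℕ∞) ≤
      affineDim V + ((Fintype.card E + Fintype.card σ' : ℕ) : WithBot ℕ∞) := by
  classical
  let τ := {s // s ∉ Set.range ι}
  let e : σ' ⊕ τ ≃ σ := (Equiv.sumCongr (Equiv.ofInjective ι ι.injective) (Equiv.refl _)).trans
    (Equiv.Set.sumCompl (Set.range ι))
  have he : ∀ s, e (Sum.inl s) = ι s := fun s => rfl
  have hes : ∀ s, e.symm (ι s) = Sum.inl s := fun s => by rw [← he, e.symm_apply_apply]
  have hfin : FiniteRingKrullDim (MvPolynomial σ' K ⧸ vanishingIdeal K V') := by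
    obtain ⟨k, hk⟩ := exists_affineDim_eq hne
    rw [finiteRingKrullDim_iff_ne_bot_and_top]
    change affineDim V' ≠ ⊥ ∧ affineDim V' ≠ ⊤
    rw [hk]
    exact ⟨WithBot.coe_ne_bot, fun h => ENat.natCast_ne_top k (WithBot.coe_injective h)⟩
  let π := Ideal.Quotient.mk (vanishingIdeal K V')
  -- the quotient by the ideal of `V'`, with the coordinates outside the range of `ι` as variables
  let Ψ : MvPolynomial σ K →+* MvPolynomial τ (MvPolynomial σ' K ⧸ vanishingIdeal K V') :=
    eval₂Hom (C.comp (π.comp C)) fun s => Sum.elim (fun s' => C (π (X s'))) X (e.symm s)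
  have hΨι : ∀ f : MvPolynomial σ' K, Ψ (rename ι f) = C (π f) := by
    intro f
    induction f using MvPolynomial.induction_on with
    | C a => simp [Ψ]
    | add f g hf hg => simp only [map_add, hf, hg]
    | mul_X f s hf =>
      simp only [map_mul, hf, rename_X]
      simp [Ψ, hes]
  have hΨ : Function.Surjective Ψ := by
    intro f
    induction f using MvPolynomial.induction_on with
    | C b =>
      obtain ⟨f, rfl⟩ := Ideal.Quotient.mk_surjective b
      exact ⟨_, hΨι f⟩
    | add f g hf hg =>
      obtain ⟨a, rfl⟩ := hf
      obtain ⟨b, rfl⟩ := hg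
      exact ⟨a + b, map_add _ _ _⟩
    | mul_X f t hf =>
      obtain ⟨a, rfl⟩ := hf
      exact ⟨a * X (e (Sum.inr t)), by simp [Ψ]⟩
  have hqM : ∀ p, constantCoeff (Ψ (q p)) = 0 := by
    intro p
    -- restriction of polynomials to `V' × 0`
    let r : MvPolynomial σ K →ₐ[K] MvPolynomial σ' K :=
      aeval fun s => Sum.elim X (fun _ => 0) (e.symm s)
    have hr : ∀ f, constantCoeff (Ψ f) = π (r f) := by
      intro f
      induction f using MvPolynomial.induction_on with
      | C a => simp [Ψ, r, algebraMap_eq]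
      | add f g hf hg => simp only [map_add, hf, hg]
      | mul_X f s hf =>
        simp only [map_mul, hf]
        congr 1
        simp only [Ψ, r, aeval_X, eval₂Hom_X']
        rcases e.symm s with s | s <;> simp
    rw [hr, Ideal.Quotient.eq_zero_iff_mem]
    intro x hx
    have hx0 : aeval x (r (q p)) = eval (fun s => Sum.elim x (fun _ => 0) (e.symm s)) (q p) := by
      rw [← aeval_eq_eval, ← AlgHom.comp_apply]
      congr 1
      ext s
      simp only [AlgHom.comp_apply, r, aeval_X]
      rcases e.symm s with s | s <;> simp
    rw [hx0]
    apply hq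
    · convert hx using 1
      ext s
      simp [hes]
    · intro s hs
      obtain ⟨s | s, rfl⟩ := e.surjective s
      · exact absurd ⟨s, rfl⟩ hs
      · simp
  have h := ringKrullDim_add_card_le Ψ hΨ q hqM
  have hJ : ringKrullDim (MvPolynomial σ K ⧸ (Ideal.span (Set.range (Ψ ∘ q))).comap Ψ) ≤
      affineDim V := by
    rw [← affineDim_zeroLocus]
    refine affineDim_mono fun x hx => hV x (hV' fun f hf => ?_) fun p => ?_
    · have : rename ι f ∈ (Ideal.span (Set.range (Ψ ∘ q))).comap Ψ := by
        rw [Ideal.mem_comap, hΨι, Ideal.Quotient.eq_zero_iff_mem.2 hf, map_zero]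
        exact zero_mem _
      simpa [aeval_rename] using hx _ this
    · have : q p ∈ (Ideal.span (Set.range (Ψ ∘ q))).comap Ψ := Ideal.subset_span ⟨p, rfl⟩
      simpa [aeval_eq_eval] using hx _ this
  have hcard : Fintype.card σ = Nat.card τ + Fintype.card σ' := by
    rw [← Nat.card_eq_fintype_card, ← Nat.card_eq_fintype_card, ← Nat.card_congr e, Nat.card_sum,
      add_comm]
  rw [hcard]
  push_cast
  rw [← add_assoc, ← add_assoc]
  refine add_le_add ?_ le_rfl

  exact h.trans (add_le_add hJ le_rfl)

end

/-! ### Dimension and transcendence degree -/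

section
universe u
variable {K : Type*} [Field K]

/-- Otherwise lifting a transcendence basis of `B` would give one of `A`, over which `a` divides a
nonzero polynomial in the basis; but `φ` is injective on such polynomials and kills `a`. -/
theorem trdeg_lt_of_surjective {A B : Type u} [CommRing A] [IsDomain A] [CommRing B] [IsDomain B]
    [Algebra K A] [Algebra K B] [Algebra.FiniteType K A] (φ : A →ₐ[K] B)
    (hφ : Function.Surjective φ) {a : A} (ha : a ≠ 0) (hφa : φ a = 0) :
    Algebra.trdeg K B < Algebra.trdeg K A := by
  by_contra hle
  rw [not_lt] at hle
  have hfin : Algebra.FiniteType K B := Algebra.FiniteType.of_surjective φ hφ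
  obtain ⟨ι, y, hy⟩ := exists_isTranscendenceBasis' K B
  have : Finite ι := by
    rw [← Cardinal.lt_aleph0_iff_finite, hy.cardinalMk_eq_trdeg]
    exact trdeg_lt_aleph0_of_finiteType
  choose x hx using fun i => hφ (y i)
  have hxy : φ ∘ x = y := funext hx
  have hxi : AlgebraicIndependent K x := AlgebraicIndependent.of_comp φ (hxy ▸ hy.1)
  have hxb : IsTranscendenceBasis K x :=
    hxi.isTranscendenceBasis_of_trdeg_le_of_finite (hle.trans hy.cardinalMk_eq_trdeg.ge)
  have hal := hxb.isAlgebraic.isAlgebraic a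
  obtain ⟨b, hb, c, hc⟩ := hal.exists_nonzero_dvd (mem_nonZeroDivisors_of_ne_zero ha)
  obtain ⟨P, hP⟩ : (b : A) ∈ (aeval x : MvPolynomial ι K →ₐ[K] A).range := by
    rw [← Algebra.adjoin_range_eq_range_aeval]
    exact b.2
  have hb' : φ b = 0 := by
    change φ (algebraMap _ A b) = 0
    rw [hc, map_mul, hφa, zero_mul]
  have hP' : aeval y P = 0 := by
    rw [← hb', ← hP, ← hxy]
    exact (congr($(comp_aeval x φ) P)).symm
  rw [hy.1.eq_zero_of_aeval_eq_zero P hP'] at hP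
  exact hb (Subtype.ext (by simpa using hP.symm))

/-- Along a chain of primes `p` the transcendence degree of `A ⧸ p` drops at each step. -/
theorem ringKrullDim_le_of_trdeg_le {A : Type u} [CommRing A] [IsDomain A] [Algebra K A]
    [Algebra.FiniteType K A] (d : ℕ) (hd : Algebra.trdeg K A ≤ d) :
    ringKrullDim A ≤ (d : WithBot ℕ∞) := by
  have hle : ∀ p : PrimeSpectrum A, Algebra.trdeg K (A ⧸ p.asIdeal) ≤ d := fun p =>
    (trdeg_le_of_surjective (Ideal.Quotient.mkₐ K p.asIdeal)
      Ideal.Quotient.mk_surjective).trans hd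
  choose t htd ht using fun p => Cardinal.exists_nat_eq_of_le_nat (hle p)
  have hmono : StrictMono fun p : PrimeSpectrum A => d - t p := by
    intro p p' hlt
    have hlt' : p.asIdeal < p'.asIdeal := hlt
    obtain ⟨a, ha', ha⟩ := SetLike.exists_of_lt hlt'
    have h := trdeg_lt_of_surjective (Ideal.Quotient.factorₐ K hlt'.le)
      (Ideal.Quotient.factor_surjective hlt'.le) (a := Ideal.Quotient.mk p.asIdeal a)
      (by rwa [Ne, Ideal.Quotient.eq_zero_iff_mem]) (by
        change Ideal.Quotient.factor hlt'.le (Ideal.Quotient.mk _ a) = 0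
        rw [Ideal.Quotient.factor_mk, Ideal.Quotient.eq_zero_iff_mem]
        exact ha')
    rw [ht, ht] at h
    have h : t p' < t p := by exact_mod_cast h
    have := htd p
    change d - t p < d - t p'
    omega
  refine iSup_le fun l => ?_
  have := LTSeries.head_add_length_le_nat (l.map _ hmono)
  have h2 : l.length ≤ d := by
    simp only [LTSeries.head_map, LTSeries.last_map, LTSeries.map_length] at this
    omega
  exact_mod_cast h2
end

/-! ### Zero sets of quadratic forms that are complete intersections -/

/-- The lowest-degree part of a product only sees the constant term of the first factor. -/
theorem homogeneousComponent_mul_of_mem_pow {K σ : Type*} [Field K] {f : MvPolynomial σ K} {k : ℕ}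
    (hf : f ∈ idealOfVars σ K ^ k) (u : MvPolynomial σ K) :
    homogeneousComponent k (u * f) = C (constantCoeff u) * homogeneousComponent k f := by
  have hu : u - C (constantCoeff u) ∈ idealOfVars σ K := by
    rw [← pow_one (idealOfVars σ K), mem_pow_idealOfVars_iff']
    intro x hx
    obtain rfl : x = 0 := by rwa [Nat.lt_one_iff, Finsupp.degree_eq_zero_iff] at hx
    rw [coeff_sub, coeff_zero_C, constantCoeff_eq, sub_self]
  have h0 : homogeneousComponent k ((u - C (constantCoeff u)) * f) = 0 := by
    have := Ideal.mul_mem_mul hu hf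
    rw [← pow_succ', mem_pow_idealOfVars_iff'] at this
    ext d
    rw [coeff_homogeneousComponent, coeff_zero]
    split_ifs with hd
    · exact this d (by omega)
    · rfl
  rw [← homogeneousComponent_C_mul, ← sub_eq_zero, ← map_sub, ← sub_mul, h0]

section
variable {K σ E D : Type*} [Field K] [Fintype σ] [Fintype E] [Fintype D]

/-- `V` is the zero set of the linearly independent quadratic forms `q`, it contains the
coordinate axes, and adding the equations `h` cuts it down to the single point `v`. The number of
equations `h` is the number of coordinates minus the number of forms `q`; it is the expected
dimension of `V`. -/
structure IsConeSystem (V : Set (σ → K)) (q : E → MvPolynomial σ K)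
    (h : D → MvPolynomial σ K) (v : σ → K) : Prop where
  eq_zeros : V = {x | ∀ p, eval x (q p) = 0}
  isolated : ∀ x, (x ∈ V ∧ ∀ i, eval x (h i) = 0) ↔ x = v
  card_add_card : Fintype.card D + Fintype.card E = Fintype.card σ
  homogeneous : ∀ p, (q p).IsHomogeneous 2
  linearIndependent : LinearIndependent K q
  single_mem : ∀ [DecidableEq σ], ∀ s a, Pi.single s a ∈ V

variable {V : Set (σ → K)} {q : E → MvPolynomial σ K} {h : D → MvPolynomial σ K} {v : σ → K}

theorem IsConeSystem.zero_mem (H : IsConeSystem V q h v) : 0 ∈ V := by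
  rw [H.eq_zeros]
  intro p
  rw [eval_zero]
  exact (H.homogeneous p).coeff_eq_zero (by simp)

variable [IsAlgClosed K]

theorem IsConeSystem.card_le_affineDim (H : IsConeSystem V q h v) :
    (Fintype.card D : WithBot ℕ∞) ≤ affineDim V := by
  obtain ⟨k, hk⟩ := exists_affineDim_eq ⟨0, H.zero_mem⟩
  have hlow := card_le_affineDim_add_card q (V := V) (fun x hx => H.eq_zeros ▸ hx) 0 fun p => by
    have h0 := H.zero_mem
    rw [H.eq_zeros] at h0
    exact h0 p
  rw [hk, ← H.card_add_card] at hlow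
  have hlow : Fintype.card D + Fintype.card E ≤ k + Fintype.card E := by exact_mod_cast hlow
  rw [hk]
  exact_mod_cast (by lia : Fintype.card D ≤ k)

/-- If `c` polynomials cut out `V`, then together with `h` they cut out a point, so that `c` is at
least the number of forms `q`. -/
theorem IsConeSystem.isSetCompleteIntersection_iff (H : IsConeSystem V q h v) :
    IsSetCompleteIntersection V ↔ affineDim V ≤ (Fintype.card D : WithBot ℕ∞) := by
  have hV := H.eq_zeros
  have hiso := H.isolated
  have hcard := H.card_add_card
  obtain ⟨k, hk⟩ := exists_affineDim_eq ⟨0, H.zero_mem⟩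
  have hlow := H.card_le_affineDim
  rw [hk] at hlow ⊢
  have hlow : Fintype.card D ≤ k := by exact_mod_cast hlow
  refine ⟨?_, fun hle => ?_⟩
  · rintro ⟨c, f, hf, hc⟩
    rw [hk] at hc
    have hc : k + c = Fintype.card σ := by exact_mod_cast hc
    have := card_le_card_of_forall_eq (Sum.elim f h) v (fun x => by
      rw [← hiso, hf]; simp [commonZeros])
    simp only [Fintype.card_sum, Fintype.card_fin] at this
    exact_mod_cast (by lia : k ≤ Fintype.card D)
  · have hle : k ≤ Fintype.card D := by exact_mod_cast hle
    refine ⟨Fintype.card E, q ∘ (Fintype.equivFin E).symm, ?_, ?_⟩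
    · rw [hV]
      ext x
      simp only [commonZeros, Set.mem_ofPred_eq, Function.comp]
      exact ((Fintype.equivFin E).symm.forall_congr_right (q := fun p => eval x (q p) = 0)).symm
    · rw [hk]
      exact_mod_cast (by lia : k + Fintype.card E = Fintype.card σ)

/-- A graded Nakayama argument: if the ideal of `V` has as many generators `f` as there are forms
`q`, write `q = A f`. Comparing quadratic parts shows that `A` is invertible at the origin, so the
determinant of `A` is a polynomial with nonzero constant term that multiplies the ideal of `V` into
the ideal of the forms `q`; both ideals being homogeneous, they agree. -/
theorem IsConeSystem.vanishingIdeal_eq_span_of_card_eq (H : IsConeSystem V q h v)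
    (f : E → MvPolynomial σ K) (hf : vanishingIdeal K V = Ideal.span (Set.range f)) :
    vanishingIdeal K V = Ideal.span (Set.range q) := by
  classical
  have hV := H.eq_zeros
  have hz := H.zero_mem
  let : GradedAlgebra (homogeneousSubmodule σ K) := gradedAlgebra
  set J := Ideal.span (Set.range q)
  have hVJ : V = zeroLocus K J := by
    rw [hV, zeroLocus_span]
    ext; simp [aeval_eq_eval]
  have hJ : J.IsHomogeneous (homogeneousSubmodule σ K) :=
    Ideal.homogeneous_span _ _ (by rintro _ ⟨p, rfl⟩; exact ⟨2, H.homogeneous p⟩)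
  have hI : (vanishingIdeal K V).IsHomogeneous (homogeneousSubmodule σ K) := by
    rw [hVJ, vanishingIdeal_zeroLocus_eq_radical]
    exact hJ.radical
  have hJI : J ≤ vanishingIdeal K V := by
    rw [hVJ]
    exact le_vanishingIdeal_zeroLocus J
  -- a polynomial vanishing on all the coordinate axes has no terms of degree less than two
  have hsq : vanishingIdeal K V ≤ idealOfVars σ K ^ 2 := by
    intro g hg
    rw [mem_pow_idealOfVars_iff']
    intro x hx
    have hc := homogeneousComponent_mem_of_mem hI hg
    obtain hx | hx : x.degree = 0 ∨ x.degree = 1 := by omega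
    · rw [Finsupp.degree_eq_zero_iff] at hx
      subst hx
      have := hc 0 0 hz
      rw [homogeneousComponent_zero] at this
      simpa using this
    · have hspan : homogeneousComponent 1 g ∈
          Submodule.span K (Set.range (X : σ → MvPolynomial σ K)) := by
        rw [← homogeneousSubmodule_one_eq_span_X]
        exact homogeneousComponent_mem _ _
      obtain ⟨c, hcs⟩ := (Submodule.mem_span_range_iff_exists_fun K).1 hspan
      have hc0 : ∀ s, c s = 0 := by
        intro s
        have := hc 1 _ (H.single_mem s 1)
        rw [← hcs] at this
        simpa [Pi.single_apply] using this
      have hx1 : coeff x (homogeneousComponent 1 g) = 0 := by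
        simp [← hcs, hc0]
      rwa [coeff_homogeneousComponent, if_pos hx] at hx1
  have hfI : ∀ j, f j ∈ vanishingIdeal K V := fun j => hf ▸ Ideal.subset_span ⟨j, rfl⟩
  have hex : ∀ p, ∃ a : E → MvPolynomial σ K, ∑ j, a j * f j = q p := by
    intro p
    have : q p ∈ Ideal.span (Set.range f) := hf ▸ hJI (Ideal.subset_span ⟨p, rfl⟩)
    exact Ideal.mem_span_range_iff_exists_fun.1 this
  choose a ha using hex
  let A : Matrix E E (MvPolynomial σ K) := Matrix.of a
  let A₀ : Matrix E E K := A.map constantCoeff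
  have hA₀ : A₀.det ≠ 0 := by
    intro hdet
    obtain ⟨w, hw, hwA⟩ := Matrix.exists_vecMul_eq_zero_iff.2 hdet
    refine hw (funext fun p => Fintype.linearIndependent_iff.1 H.linearIndependent w ?_ p)
    have hq2 : ∀ p, q p = ∑ j, A₀ p j • homogeneousComponent 2 (f j) := by
      intro p
      have : homogeneousComponent 2 (q p) = q p := homogeneousComponent_eq_self (H.homogeneous p)
      rw [← this, ← ha, map_sum]
      refine Finset.sum_congr rfl fun j _ => ?_
      rw [homogeneousComponent_mul_of_mem_pow (hsq (hfI j)), smul_eq_C_mul]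
      rfl
    calc ∑ p, w p • q p = ∑ p, ∑ j, (w p * A₀ p j) • homogeneousComponent 2 (f j) := by
          refine Finset.sum_congr rfl fun p _ => ?_
          conv_lhs => rw [hq2 p]
          rw [Finset.smul_sum]
          exact Finset.sum_congr rfl fun j _ => smul_smul _ _ _
      _ = ∑ j, (Matrix.vecMul w A₀) j • homogeneousComponent 2 (f j) := by
          rw [Finset.sum_comm]
          refine Finset.sum_congr rfl fun j _ => ?_
          rw [← Finset.sum_smul]
          rfl
      _ = 0 := by simp [hwA]
  have hdet : constantCoeff A.det ≠ 0 := by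
    rw [RingHom.map_det]
    exact hA₀
  have hAf : ∀ j, A.det * f j ∈ J := by
    intro j
    have h1 : A.mulVec f = q := funext fun p => ha p
    have h2 : A.adjugate.mulVec q = A.det • f := by
      rw [← h1, Matrix.mulVec_mulVec, Matrix.adjugate_mul, Matrix.smul_mulVec, Matrix.one_mulVec]
    have h3 := congrFun h2 j
    simp only [Pi.smul_apply, smul_eq_mul] at h3
    rw [← h3]
    exact Ideal.sum_mem _ fun p _ => Ideal.mul_mem_left _ _ (Ideal.subset_span ⟨p, rfl⟩)
  have hAI : ∀ g ∈ vanishingIdeal K V, A.det * g ∈ J := by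
    intro g hg
    rw [hf] at hg
    obtain ⟨c, rfl⟩ := Ideal.mem_span_range_iff_exists_fun.1 hg
    rw [Finset.mul_sum]
    refine Ideal.sum_mem _ fun j _ => ?_
    rw [mul_left_comm]
    exact Ideal.mul_mem_left _ _ (hAf j)
  -- the determinant only contributes its constant term in the lowest degree of each component
  refine le_antisymm (fun g hg => ?_) hJI
  rw [← sum_homogeneousComponent g]
  refine Ideal.sum_mem _ fun k _ => ?_
  have hgk := hAI _ (homogeneousComponent_mem_of_mem hI hg k)
  have hk : homogeneousComponent k g ∈ idealOfVars σ K ^ k := by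
    rw [mem_pow_idealOfVars_iff']
    intro x hx
    rw [coeff_homogeneousComponent, if_neg (by omega)]
  have h1 := homogeneousComponent_mem_of_mem hJ hgk k
  rw [homogeneousComponent_mul_of_mem_pow hk,
    homogeneousComponent_eq_self (homogeneousComponent_mem k g)] at h1
  have h2 := J.mul_mem_left (C (constantCoeff A.det)⁻¹) h1
  rwa [← mul_assoc, ← C_mul, inv_mul_cancel₀ hdet, C_1, one_mul] at h2

theorem IsConeSystem.isIdealCompleteIntersection_iff (H : IsConeSystem V q h v) :
    IsIdealCompleteIntersection V ↔ affineDim V ≤ (Fintype.card D : WithBot ℕ∞) ∧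
      vanishingIdeal K V = Ideal.span (Set.range q) := by
  have hV := H.eq_zeros
  have hcard := H.card_add_card
  have hlow := H.card_le_affineDim
  constructor
  · rintro ⟨c, f, hf, hfI, hc⟩
    have hle := H.isSetCompleteIntersection_iff.1 ⟨c, f, hf, hc⟩
    refine ⟨hle, ?_⟩
    rw [le_antisymm hle hlow] at hc
    have hc : Fintype.card D + c = Fintype.card σ := by exact_mod_cast hc
    have hc : Fintype.card E = c := by lia
    let e : E ≃ Fin c := Fintype.equivFinOfCardEq hc
    refine H.vanishingIdeal_eq_span_of_card_eq (f ∘ e) ?_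
    rw [hfI, e.surjective.range_comp]
  · rintro ⟨hle, hI⟩
    refine ⟨Fintype.card E, q ∘ (Fintype.equivFin E).symm, ?_, ?_, ?_⟩
    · rw [hV]
      ext x
      simp only [commonZeros, Set.mem_ofPred_eq, Function.comp]
      exact ((Fintype.equivFin E).symm.forall_congr_right (q := fun p => eval x (q p) = 0)).symm
    · rw [hI, (Fintype.equivFin E).symm.surjective.range_comp]
    · rw [le_antisymm hle hlow]
      exact_mod_cast hcard
end

/-! ### Adding coordinates to a cone system -/

section step
variable {K σ E D σ' E' D' : Type*} [Field K] [Fintype σ] [Fintype E] [Fintype D]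
  [Fintype σ'] [Fintype E'] [Fintype D']
  {V : Set (σ → K)} {q : E → MvPolynomial σ K} {h : D → MvPolynomial σ K} {v : σ → K}
  {V' : Set (σ' → K)} {q' : E' → MvPolynomial σ' K} {h' : D' → MvPolynomial σ' K} {v' : σ' → K}

/-- The forms `q` extend the forms `q'` along the inclusions `ι` of coordinates and `j` of index
sets: the old forms are the same, and the new ones vanish where all the new coordinates do. -/
structure IsExtension (q : E → MvPolynomial σ K) (q' : E' → MvPolynomial σ' K) (ι : σ' ↪ σ)
    (j : E' ↪ E) : Prop where
  apply_old : ∀ p, q (j p) = rename ι (q' p)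
  eval_new : ∀ p ∉ Set.range j, ∀ x, (∀ s ∉ Set.range ι, x s = 0) → eval x (q p) = 0

variable {ι : σ' ↪ σ} {j : E' ↪ E}

theorem IsExtension.comp_mem (X : IsExtension q q' ι j) (H : IsConeSystem V q h v)
    (H' : IsConeSystem V' q' h' v') {x : σ → K} (hx : x ∈ V) : x ∘ ι ∈ V' := by
  rw [H.eq_zeros] at hx
  rw [H'.eq_zeros]
  intro p
  rw [← eval_rename, ← X.apply_old]
  exact hx _

theorem IsExtension.extend_mem (X : IsExtension q q' ι j) (H : IsConeSystem V q h v)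
    (H' : IsConeSystem V' q' h' v') {x : σ' → K} (hx : x ∈ V') :
    Function.extend ι x 0 ∈ V := by
  rw [H'.eq_zeros] at hx
  rw [H.eq_zeros]
  intro p
  by_cases hp : p ∈ Set.range j
  · obtain ⟨p, rfl⟩ := hp
    rw [X.apply_old, eval_rename, Function.extend_comp ι.injective]
    exact hx p
  · exact X.eval_new p hp _ fun s hs => Function.extend_apply' _ _ _ hs

theorem IsExtension.zariskiIrreducible (X : IsExtension q q' ι j) (H : IsConeSystem V q h v)
    (H' : IsConeSystem V' q' h' v') (hV : ZariskiIrreducible V) : ZariskiIrreducible V' := by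
  refine ⟨⟨0, H'.zero_mem⟩, fun I J hIJ => ?_⟩
  have key : ∀ (I : Ideal (MvPolynomial σ' K)) (x : σ → K),
      x ∈ zeroLocus K (I.map (rename ι)) ↔ x ∘ ι ∈ zeroLocus K I := by
    intro I x
    rw [Ideal.map, zeroLocus_span]
    simp [aeval_eq_eval, eval_rename]
  have key2 : ∀ I : Ideal (MvPolynomial σ' K), V ⊆ zeroLocus K (I.map (rename ι)) →
      V' ⊆ zeroLocus K I := by
    intro I hI x hx
    have := (key I _).1 (hI (X.extend_mem H H' hx))
    rwa [Function.extend_comp ι.injective] at this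
  refine (hV.2 (I.map (rename ι)) (J.map (rename ι)) fun x hx => ?_).imp (key2 I) (key2 J)
  exact (hIJ (X.comp_mem H H' hx)).imp (key I x).2 (key J x).2

variable [IsAlgClosed K]

theorem IsExtension.affineDim_le (X : IsExtension q q' ι j) (H : IsConeSystem V q h v)
    (H' : IsConeSystem V' q' h' v') (hV : affineDim V ≤ (Fintype.card D : WithBot ℕ∞)) :
    affineDim V' ≤ (Fintype.card D' : WithBot ℕ∞) := by
  classical
  have hcl : zeroLocus K (vanishingIdeal K V') ⊆ V' := by
    intro x hx
    rw [H'.eq_zeros]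
    intro p
    refine (aeval_eq_eval x ▸ hx (q' p) fun y hy => ?_)
    rw [H'.eq_zeros] at hy
    simpa [aeval_eq_eval] using hy p
  obtain ⟨k, hk⟩ := exists_affineDim_eq ⟨0, H.zero_mem⟩
  obtain ⟨k', hk'⟩ := exists_affineDim_eq ⟨0, H'.zero_mem⟩
  have key := affineDim_add_card_le (V := V) (V' := V') ι hcl ⟨0, H'.zero_mem⟩
    (fun p : {p // p ∉ Set.range j} => q p) (fun x hx hxq => by
      rw [H.eq_zeros]
      intro p
      by_cases hp : p ∈ Set.range j
      · obtain ⟨p, rfl⟩ := hp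
        rw [X.apply_old, eval_rename]
        rw [H'.eq_zeros] at hx
        exact hx p
      · exact hxq ⟨p, hp⟩)
    (fun p x _ hx => X.eval_new p.1 p.2 x hx)
  have hE : Fintype.card {p // p ∉ Set.range j} + Fintype.card E' = Fintype.card E := by
    rw [Fintype.card_subtype_compl, ← Fintype.card_congr (Equiv.ofInjective j j.injective)]
    exact Nat.sub_add_cancel (Fintype.card_le_of_injective j j.injective)
  rw [hk, hk'] at key
  rw [hk] at hV
  rw [hk']
  have key : k' + Fintype.card σ ≤ k + (Fintype.card {p // p ∉ Set.range j} + Fintype.card σ') := by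
    exact_mod_cast key
  have hV : k ≤ Fintype.card D := by exact_mod_cast hV
  have h1 := H.card_add_card
  have h2 := H'.card_add_card
  exact_mod_cast (by lia : k' ≤ Fintype.card D')

/-- The old quotient ring is a retract of the new one, hence reduced if the new one is. -/
theorem IsExtension.vanishingIdeal_eq (X : IsExtension q q' ι j) (H : IsConeSystem V q h v)
    (H' : IsConeSystem V' q' h' v') (hV : vanishingIdeal K V = Ideal.span (Set.range q)) :
    vanishingIdeal K V' = Ideal.span (Set.range q') := by
  -- the retraction setting the new coordinates to zero
  let r : MvPolynomial σ K →ₐ[K] MvPolynomial σ' K := aeval (Function.extend ι MvPolynomial.X 0)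
  have hrι : ∀ f, r (rename ι f) = f := by
    intro f
    simp only [r, aeval_rename, Function.extend_comp ι.injective, aeval_X_left_apply]
  apply le_antisymm
  · intro f hf
    have h1 : rename ι f ∈ Ideal.span (Set.range q) := by
      rw [← hV]
      intro x hx
      rw [aeval_rename]
      exact hf _ (X.comp_mem H H' hx)
    rw [← hrι f]
    have h2 : Ideal.span (Set.range q) ≤ (Ideal.span (Set.range q')).comap r := by
      rw [Ideal.span_le]
      rintro _ ⟨p, rfl⟩
      change r (q p) ∈ Ideal.span (Set.range q')
      by_cases hp : p ∈ Set.range j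
      · obtain ⟨p, rfl⟩ := hp
        rw [X.apply_old, hrι]
        exact Ideal.subset_span ⟨p, rfl⟩
      · have : r (q p) = 0 := by
          refine MvPolynomial.funext fun x => ?_
          rw [map_zero, ← X.eval_new p hp (Function.extend ι x 0)
            fun s hs => Function.extend_apply' _ _ _ hs, ← aeval_eq_eval, ← aeval_eq_eval,
            ← AlgHom.comp_apply]
          congr 1
          ext s
          simp only [AlgHom.comp_apply, r, aeval_X]
          by_cases hs : s ∈ Set.range ι
          · obtain ⟨s, rfl⟩ := hs
            simp [ι.injective.extend_apply]
          · simp [Function.extend_apply' _ _ _ hs]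
        rw [this]
        exact Submodule.zero_mem _
    exact h2 h1
  · rw [Ideal.span_le]
    rintro _ ⟨p, rfl⟩ x hx
    rw [H'.eq_zeros] at hx
    simpa [aeval_eq_eval] using hx p

theorem IsExtension.step (X : IsExtension q q' ι j) (H : IsConeSystem V q h v)
    (H' : IsConeSystem V' q' h' v') :
    (¬ ZariskiIrreducible V' → ¬ ZariskiIrreducible V) ∧
      (¬ IsSetCompleteIntersection V' → ¬ IsSetCompleteIntersection V) ∧
      (¬ IsIdealCompleteIntersection V' → ¬ IsIdealCompleteIntersection V) := by
  refine ⟨mt (X.zariskiIrreducible H H'), mt fun hV => ?_, mt fun hV => ?_⟩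
  · rw [H'.isSetCompleteIntersection_iff]
    exact X.affineDim_le H H' (H.isSetCompleteIntersection_iff.1 hV)
  · rw [H.isIdealCompleteIntersection_iff] at hV
    rw [H'.isIdealCompleteIntersection_iff]
    exact ⟨X.affineDim_le H H' hV.1, X.vanishingIdeal_eq H H' hV.2⟩

end step

/-! ### Irreducible sets -/

section irreducible
universe u w
variable {K : Type u} {σ : Type w} [Field K]

theorem ZariskiIrreducible.isPrime_vanishingIdeal {V : Set (σ → K)} (hV : ZariskiIrreducible V) :
    (vanishingIdeal K V).IsPrime := by
  obtain ⟨⟨v, hv⟩, hV⟩ := hV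
  refine ⟨fun h => ?_, fun {f g} hfg => ?_⟩
  · rw [Ideal.eq_top_iff_one] at h
    simpa using h v hv
  · have key : ∀ f : MvPolynomial σ K, V ⊆ zeroLocus K (Ideal.span {f}) → f ∈ vanishingIdeal K V :=
      fun f hf x hx => hf hx f (Ideal.mem_span_singleton_self f)
    refine (hV (Ideal.span {f}) (Ideal.span {g}) fun x hx => ?_).imp (key f) (key g)
    have := hfg x hx
    rw [map_mul, mul_eq_zero] at this
    simpa [zeroLocus_span] using this

/-- If the coordinates of the generic point `x` of an irreducible set all lie in the field
generated by the coordinates at the positions `z`, then these bound the dimension. -/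
theorem ZariskiIrreducible.affineDim_le [Fintype σ] {D : Type*} [Fintype D] {V : Set (σ → K)}
    (hV : ZariskiIrreducible V) (z : D → σ)
    (hz : ∀ (L : Type (max u w)) [Field L] [Algebra K L] (x : σ → L),
      (∀ f, aeval x f = 0 ↔ f ∈ vanishingIdeal K V) →
      ∀ F : IntermediateField K L, (∀ i, x (z i) ∈ F) → ∀ s, x s ∈ F) :
    affineDim V ≤ (Fintype.card D : WithBot ℕ∞) := by
  have hp := hV.isPrime_vanishingIdeal
  let B := MvPolynomial σ K ⧸ vanishingIdeal K V
  let L := FractionRing B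
  let π : MvPolynomial σ K →ₐ[K] L := (Algebra.ofId B L).restrictScalars K |>.comp
    (Ideal.Quotient.mkₐ K (vanishingIdeal K V))
  let x : σ → L := fun s => π (X s)
  have hπ : aeval x = π := by ext s; simp [x]
  have hx : ∀ f, aeval x f = 0 ↔ f ∈ vanishingIdeal K V := by
    intro f
    rw [hπ, ← Ideal.Quotient.eq_zero_iff_mem]
    exact map_eq_zero_iff (algebraMap B L) (IsFractionRing.injective B L)
  let S := Set.range (x ∘ z)
  let F := IntermediateField.adjoin K S
  have hF : ∀ s, x s ∈ F := hz L x hx F fun i => IntermediateField.subset_adjoin K S ⟨i, rfl⟩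
  have hBF : ∀ b : B, algebraMap B L b ∈ F := by
    intro b
    obtain ⟨f, rfl⟩ := Ideal.Quotient.mk_surjective b
    change π f ∈ F
    rw [← hπ]
    exact (Algebra.adjoin_le (S := F.toSubalgebra) (Set.range_subset_iff.2 hF))
      (Algebra.adjoin_range_eq_range_aeval K x ▸ AlgHom.mem_range_self (aeval x) f)
  have halg : Algebra.IsAlgebraic (Algebra.adjoin K S) L := by
    have hFa : ∀ y ∈ F, IsAlgebraic (Algebra.adjoin K S) y := by
      intro y hy
      obtain ⟨a, ha, b, hb, rfl⟩ := IntermediateField.mem_adjoin_iff_div.1 hy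
      rw [div_eq_mul_inv]
      exact (isAlgebraic_algebraMap (⟨a, ha⟩ : Algebra.adjoin K S)).mul
        (isAlgebraic_algebraMap (⟨b, hb⟩ : Algebra.adjoin K S)).inv
    refine ⟨fun y => ?_⟩
    obtain ⟨a, b, hb, rfl⟩ := IsFractionRing.div_surjective (A := B) y
    exact hFa _ (div_mem (hBF a) (hBF b))
  refine ringKrullDim_le_of_trdeg_le (K := K) (A := B) _ ?_
  calc Algebra.trdeg K B ≤ Algebra.trdeg K L :=
        trdeg_le_of_injective ((Algebra.ofId B L).restrictScalars K) (IsFractionRing.injective B L)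
    _ ≤ Cardinal.mk S := Algebra.IsAlgebraic.trdeg_le_cardinalMk K S
    _ ≤ Fintype.card D := by
        have : Finite S := Set.finite_range _
        rw [← Nat.cast_card, ← Nat.card_eq_fintype_card]
        exact_mod_cast Finite.card_range_le (x ∘ z)

end irreducible

/-! ### Commuting matrices supported on a relation -/

section pattern
variable {n : ℕ} (R : Fin n → Fin n → Prop) [DecidableRel R]

/-- The positions `(i, j)` with `R i j`: the coordinates of the space of matrices supported
on `R`. -/
abbrev Pos : Type := {p : Fin n × Fin n // R p.1 p.2}

/-- The matrix supported on `R` with the given entries there. -/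
def patternMatrix {A : Type*} [CommRing A] (a : Pos R → A) : Matrix (Fin n) (Fin n) A :=
  Matrix.of fun i j => if h : R i j then a ⟨(i, j), h⟩ else 0

/-- The commutator of the two matrices supported on `R` whose entries are the two halves
of `x`. -/
def pairComm {A : Type*} [CommRing A] (x : Pos R ⊕ Pos R → A) : Matrix (Fin n) (Fin n) A :=
  patternMatrix R (x ∘ Sum.inl) * patternMatrix R (x ∘ Sum.inr) -
    patternMatrix R (x ∘ Sum.inr) * patternMatrix R (x ∘ Sum.inl)

/-- The entry of the commutator of two generic matrices supported on `R`, a polynomial in their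
entries. -/
noncomputable def commPoly (K : Type*) [Field K] (i j : Fin n) : MvPolynomial (Pos R ⊕ Pos R) K :=
  pairComm R X i j

/-- Pairs of commuting matrices supported on `R`. -/
def commutingPairs (K : Type*) [Field K] : Set (Pos R ⊕ Pos R → K) := {x | pairComm R x = 0}

variable {R} {A A' : Type*} [CommRing A] [CommRing A']

theorem patternMatrix_apply (a : Pos R → A) (p : Pos R) :
    patternMatrix R a p.1.1 p.1.2 = a p := by
  simp [patternMatrix, p.2]

theorem patternMatrix_eq_zero (a : Pos R → A) {i j : Fin n} (h : ¬ R i j) :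
    patternMatrix R a i j = 0 := by
  simp [patternMatrix, h]

theorem pairComm_apply (x : Pos R ⊕ Pos R → A) (i j : Fin n) :
    pairComm R x i j = ∑ k, (patternMatrix R (x ∘ Sum.inl) i k * patternMatrix R (x ∘ Sum.inr) k j -
      patternMatrix R (x ∘ Sum.inr) i k * patternMatrix R (x ∘ Sum.inl) k j) := by
  simp [pairComm, Matrix.mul_apply]

theorem map_patternMatrix (φ : A →+* A') (a : Pos R → A) (i j : Fin n) :
    φ (patternMatrix R a i j) = patternMatrix R (φ ∘ a) i j := by
  by_cases h : R i j <;> simp [patternMatrix, h]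

theorem map_pairComm (φ : A →+* A') (x : Pos R ⊕ Pos R → A) (i j : Fin n) :
    φ (pairComm R x i j) = pairComm R (φ ∘ x) i j := by
  simp only [pairComm_apply, map_sum, map_sub, map_mul, map_patternMatrix, Function.comp_assoc]

variable {K : Type*} [Field K]

theorem aeval_commPoly [Algebra K A] (x : Pos R ⊕ Pos R → A) (i j : Fin n) :
    aeval x (commPoly R K i j) = pairComm R x i j := by
  have h : (aeval x : MvPolynomial (Pos R ⊕ Pos R) K →ₐ[K] A).toRingHom ∘ X = x :=
    funext fun s => aeval_X x s
  exact (map_pairComm _ X i j).trans (by rw [h])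

theorem eval_commPoly (x : Pos R ⊕ Pos R → K) (i j : Fin n) :
    eval x (commPoly R K i j) = pairComm R x i j := by
  rw [← aeval_commPoly (K := K), aeval_eq_eval]

theorem isHomogeneous_commPoly (i j : Fin n) : (commPoly R K i j).IsHomogeneous 2 := by
  have h : ∀ (f : Pos R → Pos R ⊕ Pos R) (i j : Fin n),
      (patternMatrix R (fun p => (X (f p) : MvPolynomial (Pos R ⊕ Pos R) K)) i j).IsHomogeneous 1 := by
    intro f i j
    by_cases h : R i j
    · simpa [patternMatrix, h] using isHomogeneous_X K _
    · simpa [patternMatrix, h] using isHomogeneous_zero _ K 1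
  rw [commPoly, pairComm_apply]
  exact IsHomogeneous.sum _ _ _ fun k _ => ((h _ i k).mul (h _ k j)).sub ((h _ i k).mul (h _ k j))

theorem patternMatrix_single [DecidableEq (Pos R)] (p : Pos R) (a : A) :
    patternMatrix R (Pi.single p a) = Matrix.single p.1.1 p.1.2 a := by
  ext i j
  by_cases h : R i j
  · simp only [patternMatrix, Matrix.of_apply, h, dite_true, Pi.single_apply, Matrix.single_apply,
      Subtype.ext_iff, Prod.ext_iff]
    exact if_congr (by rw [eq_comm, eq_comm (a := j)]) rfl rfl
  · rw [patternMatrix_eq_zero _ h, Matrix.single_apply, if_neg]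
    rintro ⟨rfl, rfl⟩
    exact h p.2

theorem patternMatrix_zero : patternMatrix R (0 : Pos R → A) = 0 := by
  ext i j
  simp [patternMatrix]

theorem elim_zero_mem_commutingPairs (x₀ : Pos R → K) :
    Sum.elim x₀ 0 ∈ commutingPairs R K := by
  change pairComm R _ = 0
  rw [pairComm, Sum.elim_comp_inr, patternMatrix_zero, mul_zero, zero_mul, sub_zero]

theorem single_mem_commutingPairs [DecidableEq (Pos R ⊕ Pos R)] (s : Pos R ⊕ Pos R) (a : K) :
    Pi.single s a ∈ commutingPairs R K := by
  change pairComm R (Pi.single s a) = 0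
  rcases s with p | p
  · have : (Pi.single (Sum.inl p) a : Pos R ⊕ Pos R → K) ∘ Sum.inr = 0 := by
      ext; simp
    rw [pairComm, this, patternMatrix_zero]
    simp
  · have : (Pi.single (Sum.inr p) a : Pos R ⊕ Pos R → K) ∘ Sum.inl = 0 := by
      ext; simp
    rw [pairComm, this, patternMatrix_zero]
    simp

/-- The matrix units `E_ik` and `E_kj` have commutator `E_ij`, so evaluation at such pairs separates
the polynomials. -/
theorem linearIndependent_commPoly {E : Fin n → Fin n → Prop}
    [Fintype {p : Fin n × Fin n // E p.1 p.2}]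
    (hE : ∀ i j, E i j → i ≠ j ∧ ∃ k, R i k ∧ R k j) :
    LinearIndependent K fun p : {p : Fin n × Fin n // E p.1 p.2} => commPoly R K p.1.1 p.1.2 := by
  classical
  rw [Fintype.linearIndependent_iff]
  rintro w hw ⟨⟨i, j⟩, hij⟩
  obtain ⟨hne, k, hik, hkj⟩ := hE i j hij
  let x : Pos R ⊕ Pos R → K :=
    Sum.elim (Pi.single ⟨(i, k), hik⟩ 1) (Pi.single ⟨(k, j), hkj⟩ 1)
  have hx : pairComm R x = Matrix.single i j 1 := by
    rw [pairComm, Sum.elim_comp_inl, Sum.elim_comp_inr, patternMatrix_single, patternMatrix_single]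
    simp [Matrix.single_mul_single_of_ne, hne.symm]
  have h := congrArg (eval x) hw
  simp only [map_sum, smul_eval, eval_commPoly, hx, Matrix.single_apply, map_zero] at h
  rw [Finset.sum_eq_single ⟨(i, j), hij⟩] at h
  · simpa using h
  · rintro ⟨⟨i', j'⟩, _⟩ _ hne'
    rw [if_neg, mul_zero]
    rintro ⟨rfl, rfl⟩
    exact hne' rfl
  · simp

/-- Commuting pairs as a cone system: `E` is the set of positions where the commutator does not
vanish identically, and `x₀` is a matrix such that a matrix commuting with it is determined by its
entries at the positions `z`. The isolating equations fix the first matrix to be `x₀` and the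
entries at `z` of the second one to be zero. -/
theorem isConeSystem_commutingPairs {E : Fin n → Fin n → Prop}
    [Fintype {p : Fin n × Fin n // E p.1 p.2}] {D : Type*} [Fintype D] (z : D → Pos R)
    (hE₀ : ∀ x : Pos R ⊕ Pos R → K, ∀ i j, ¬ E i j → pairComm R x i j = 0)
    (hE : ∀ i j, E i j → i ≠ j ∧ ∃ k, R i k ∧ R k j)
    (hcard : Fintype.card D + Fintype.card {p : Fin n × Fin n // E p.1 p.2} =
      Fintype.card (Pos R)) (x₀ : Pos R → K)
    (hx₀ : ∀ y : Pos R → K, pairComm R (Sum.elim x₀ y) = 0 → (∀ d, y (z d) = 0) → y = 0) :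
    IsConeSystem (commutingPairs R K)
      (fun p : {p : Fin n × Fin n // E p.1 p.2} => commPoly R K p.1.1 p.1.2)
      (Sum.elim (fun e => X (Sum.inl e) - C (x₀ e)) (fun d => X (Sum.inr (z d))))
      (Sum.elim x₀ 0) where
  eq_zeros := by
    ext x
    simp only [commutingPairs, Set.mem_ofPred_eq, eval_commPoly]
    refine ⟨fun h p => by rw [h]; rfl, fun h => ?_⟩
    ext i j
    by_cases hij : E i j
    · exact h ⟨(i, j), hij⟩
    · exact hE₀ x i j hij
  isolated := by
    intro x
    constructor
    · rintro ⟨hx, h⟩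
      have h1 : x ∘ Sum.inl = x₀ := funext fun e => by simpa [sub_eq_zero] using h (Sum.inl e)
      have h2 : x = Sum.elim x₀ (x ∘ Sum.inr) := by rw [← h1, Sum.elim_comp_inl_inr]
      have h3 : x ∘ Sum.inr = 0 := by
        refine hx₀ _ (h2 ▸ hx) fun d => by simpa using h (Sum.inr d)
      rw [h2, h3]
    · rintro rfl
      exact ⟨elim_zero_mem_commutingPairs x₀, by rintro (e | d) <;> simp⟩
  card_add_card := by
    simp only [Fintype.card_sum]
    lia
  homogeneous := fun p => isHomogeneous_commPoly _ _
  linearIndependent := linearIndependent_commPoly hE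
  single_mem := single_mem_commutingPairs

end pattern

section extension
variable {n : ℕ} {R E : Fin n → Fin n → Prop} {R' E' : Fin (n + 1) → Fin (n + 1) → Prop}
  [DecidableRel R] [DecidableRel R'] {K : Type*} [Field K]

/-- The positions in the upper left block of size `n`, inside those of size `n + 1`. -/
def castSuccPos (hR : ∀ i j : Fin n, R' i.castSucc j.castSucc ↔ R i j) : Pos R ↪ Pos R' where
  toFun p := ⟨(p.1.1.castSucc, p.1.2.castSucc), (hR _ _).2 p.2⟩
  inj' := by
    rintro ⟨⟨i, j⟩, h⟩ ⟨⟨i', j'⟩, h'⟩ heq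
    simpa using heq

/-- Adding a last row and column: the commutator of the upper left blocks is the upper left block
of the commutator. -/
theorem isExtension_castSucc (hR : ∀ i j : Fin n, R' i.castSucc j.castSucc ↔ R i j)
    (hE : ∀ i j : Fin n, E' i.castSucc j.castSucc ↔ E i j)
    (hl : ∀ j : Fin n, ¬ R' (Fin.last n) j.castSucc) :
    IsExtension (fun p : {p : Fin (n + 1) × Fin (n + 1) // E' p.1 p.2} => commPoly R' K p.1.1 p.1.2)
      (fun p : {p : Fin n × Fin n // E p.1 p.2} => commPoly R K p.1.1 p.1.2)
      ((castSuccPos hR).sumMap (castSuccPos hR)) (castSuccPos hE) where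
  apply_old := by
    rintro ⟨⟨i, j⟩, h⟩
    have hM : ∀ (a : Pos R' → MvPolynomial (Pos R' ⊕ Pos R') K) (i j : Fin n),
        patternMatrix R' a i.castSucc j.castSucc = patternMatrix R (a ∘ castSuccPos hR) i j := by
      intro a i j
      by_cases h : R i j
      · simp only [patternMatrix, Matrix.of_apply, h, (hR i j).2 h, dite_true]
        rfl
      · simp [patternMatrix, h, hR]
    have hren : rename ((castSuccPos hR).sumMap (castSuccPos hR)) (commPoly R K i j) =
        pairComm R (X ∘ (castSuccPos hR).sumMap (castSuccPos hR)) i j := by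
      have h : (rename ((castSuccPos hR).sumMap (castSuccPos hR)) :
          MvPolynomial (Pos R ⊕ Pos R) K →ₐ[K] _).toRingHom ∘ X =
            X ∘ (castSuccPos hR).sumMap (castSuccPos hR) := funext fun s => rename_X _ s
      exact (map_pairComm _ X i j).trans (by rw [h])
    change commPoly R' K i.castSucc j.castSucc = rename _ (commPoly R K i j)
    rw [hren, commPoly, pairComm_apply, pairComm_apply, Fin.sum_univ_castSucc]
    simp only [hM, patternMatrix_eq_zero _ (hl j), mul_zero, sub_zero, add_zero]
    rfl
  eval_new := by
    rintro ⟨⟨i, j⟩, h⟩ hp x hx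
    have hM : ∀ f : Pos R' → Pos R' ⊕ Pos R', (f = Sum.inl ∨ f = Sum.inr) → ∀ i j,
        i = Fin.last n ∨ j = Fin.last n → patternMatrix R' (x ∘ f) i j = 0 := by
      intro f hf i j hij
      by_cases h : R' i j
      · simp only [patternMatrix, Matrix.of_apply, h, dite_true, Function.comp]
        refine hx _ ?_
        rintro ⟨(⟨⟨i', j'⟩, h'⟩ | ⟨⟨i', j'⟩, h'⟩), heq⟩ <;>
        · rcases hf with rfl | rfl <;>
          simp [castSuccPos, Function.Embedding.sumMap] at heq
          obtain ⟨rfl, rfl⟩ := heq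
          rcases hij with hij | hij <;> exact (Fin.castSucc_lt_last _).ne hij
      · exact patternMatrix_eq_zero _ h
    have hij : i = Fin.last n ∨ j = Fin.last n := by
      by_contra! hcon
      obtain ⟨i, rfl⟩ := Fin.exists_castSucc_eq.2 hcon.1
      obtain ⟨j, rfl⟩ := Fin.exists_castSucc_eq.2 hcon.2
      exact hp ⟨⟨(i, j), (hE i j).1 h⟩, rfl⟩
    change eval x (commPoly R' K i j) = 0
    rw [eval_commPoly, pairComm_apply]
    refine Finset.sum_eq_zero fun k _ => ?_
    rcases hij with rfl | rfl
    · rw [hM _ (.inl rfl) _ _ (.inl rfl), hM _ (.inr rfl) _ _ (.inl rfl)]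
      simp
    · rw [hM _ (.inl rfl) _ _ (.inr rfl), hM _ (.inr rfl) _ _ (.inr rfl)]
      simp

end extension

/-! ### Matrices commuting with a regular matrix -/

section recursion
variable {n : ℕ} {L : Type*} [Field L]

/-- If `X` and `Y` are commuting upper triangular matrices and the diagonal entries of `X` are
distinct, then the entries of `Y` are obtained from its diagonal entries by solving linear
equations with coefficients in the field generated by the entries of `X`. The entry `(i, j)` of
`X * Y - Y * X` expresses `(X i i - X j j) * Y i j` by entries of `Y` closer to the diagonal.
The entries of `X` lie in `F` and those of `Y` in `S`: the choice `S = 0` gives uniqueness of `Y`,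
the choice `S = F` rationality of its entries. -/
theorem patternMatrix_mem_of_commute_le (F : Subfield L) (S : AddSubgroup L)
    (hFS : ∀ a ∈ F, ∀ b ∈ S, a * b ∈ S)
    (x : Pos (n := n) (· ≤ ·) ⊕ Pos (n := n) (· ≤ ·) → L) (hx : pairComm _ x = 0)
    (hF : ∀ p, x (Sum.inl p) ∈ F)
    (hreg : ∀ i j : Fin n, i ≠ j → x (Sum.inl ⟨(i, i), le_rfl⟩) ≠ x (Sum.inl ⟨(j, j), le_rfl⟩))
    (hd : ∀ i : Fin n, x (Sum.inr ⟨(i, i), le_rfl⟩) ∈ S) (p) : x (Sum.inr p) ∈ S := by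
  set M := patternMatrix _ (x ∘ Sum.inl) with hM
  set N := patternMatrix _ (x ∘ Sum.inr) with hN
  have hMF : ∀ i j, M i j ∈ F := by
    intro i j
    by_cases h : i ≤ j
    · simpa [hM, patternMatrix, h] using hF _
    · rw [hM, patternMatrix_eq_zero _ h]
      exact F.zero_mem
  have hMd : ∀ i, M i i = x (Sum.inl ⟨(i, i), le_rfl⟩) := fun i => by simp [hM, patternMatrix]
  have hNS : ∀ m : ℕ, ∀ i j : Fin n, j.1 ≤ i.1 + m → N i j ∈ S := by
    intro m
    induction m with
    | zero =>
      intro i j hij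
      by_cases h : i ≤ j
      · obtain rfl : i = j := le_antisymm h hij
        simpa [hN, patternMatrix] using hd i
      · rw [hN, patternMatrix_eq_zero _ h]
        exact S.zero_mem
    | succ m ih =>
      intro i j hij
      by_cases hle : j.1 ≤ i.1 + m
      · exact ih i j hle
      have hne : i ≠ j := by
        rintro rfl
        lia
      have h0 := congrFun (congrFun hx i) j
      rw [pairComm_apply, Finset.sum_sub_distrib,
        Finset.sum_eq_add_sum_sdiff_singleton_of_mem (Finset.mem_univ i),
        Finset.sum_eq_add_sum_sdiff_singleton_of_mem (Finset.mem_univ j)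
          (fun k => N i k * M k j)] at h0
      have h1 : ∑ k ∈ Finset.univ \ {i}, M i k * N k j ∈ S := by
        refine S.sum_mem fun k hk => ?_
        by_cases hik : i ≤ k
        · refine hFS _ (hMF _ _) _ (ih k j ?_)
          have : i ≠ k := by simpa [eq_comm] using hk
          have := lt_of_le_of_ne hik this
          rw [Fin.lt_def] at this
          lia
        · rw [hM, patternMatrix_eq_zero _ hik, zero_mul]
          exact S.zero_mem
      have h2 : ∑ k ∈ Finset.univ \ {j}, N i k * M k j ∈ S := by
        refine S.sum_mem fun k hk => ?_
        by_cases hkj : k ≤ j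
        · rw [mul_comm]
          refine hFS _ (hMF _ _) _ (ih i k ?_)
          have : k ≠ j := by simpa using hk
          have := lt_of_le_of_ne hkj this
          rw [Fin.lt_def] at this
          lia
        · rw [hM, patternMatrix_eq_zero _ hkj, mul_zero]
          exact S.zero_mem
      have hne' : M i i - M j j ≠ 0 := by
        rw [hMd, hMd, sub_ne_zero]
        exact hreg i j hne
      have h3 : N i j = (M i i - M j j)⁻¹ * (∑ k ∈ Finset.univ \ {j}, N i k * M k j -
          ∑ k ∈ Finset.univ \ {i}, M i k * N k j) := by
        rw [eq_inv_mul_iff_mul_eq₀ hne']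
        simp only [Matrix.zero_apply] at h0
        linear_combination h0
      rw [h3]
      exact hFS _ (F.inv_mem (F.sub_mem (hMF _ _) (hMF _ _))) _ (S.sub_mem h2 h1)
  have := hNS n p.1.1 p.1.2 (by lia)
  rwa [hN, patternMatrix_apply] at this

/-- The analogue for strictly upper triangular matrices: if the entries of `X` next to the diagonal
do not vanish, the first row of `Y` determines `Y`. The entry `(i, j)` of `X * Y - Y * X` expresses
`X i (i + 1) * Y (i + 1) j` by entries of `Y` that are closer to the diagonal, or equally close and
in row `i`. -/
theorem patternMatrix_mem_of_commute_lt (F : Subfield L) (S : AddSubgroup L)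
    (hFS : ∀ a ∈ F, ∀ b ∈ S, a * b ∈ S)
    (x : Pos (n := n) (· < ·) ⊕ Pos (n := n) (· < ·) → L) (hx : pairComm _ x = 0)
    (hF : ∀ p, x (Sum.inl p) ∈ F)
    (hreg : ∀ p : Pos (n := n) (· < ·), p.1.1.1 + 1 = p.1.2.1 → x (Sum.inl p) ≠ 0)
    (hd : ∀ p : Pos (n := n) (· < ·), p.1.1.1 = 0 → x (Sum.inr p) ∈ S) (p) :
    x (Sum.inr p) ∈ S := by
  set M := patternMatrix _ (x ∘ Sum.inl) with hM
  set N := patternMatrix _ (x ∘ Sum.inr) with hN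
  have hMF : ∀ i j, M i j ∈ F := by
    intro i j
    by_cases h : i < j
    · simpa [hM, patternMatrix, h] using hF _
    · rw [hM, patternMatrix_eq_zero _ h]
      exact F.zero_mem
  have hNS : ∀ m a : ℕ, ∀ i j : Fin n, i.1 = a → j.1 ≤ i.1 + m → N i j ∈ S := by
    intro m
    induction m with
    | zero =>
      intro a i j _ hij
      rw [hN, patternMatrix_eq_zero _ (by rw [Fin.lt_def]; lia)]
      exact S.zero_mem
    | succ m ihm =>
      intro a
      induction a with
      | zero =>
        intro i j hi hij
        by_cases h : i < j
        · simpa [hN, patternMatrix, h] using hd ⟨(i, j), h⟩ hi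
        · rw [hN, patternMatrix_eq_zero _ h]
          exact S.zero_mem
      | succ a iha =>
        intro b j hb hbj
        let i : Fin n := ⟨a, by lia⟩
        have hib : i < b := by rw [Fin.lt_def]; simp [i, hb]
        have h0 := congrFun (congrFun hx i) j
        rw [pairComm_apply, Finset.sum_sub_distrib,
          Finset.sum_eq_add_sum_sdiff_singleton_of_mem (Finset.mem_univ b)] at h0
        have h1 : ∑ k ∈ Finset.univ \ {b}, M i k * N k j ∈ S := by
          refine S.sum_mem fun k hk => ?_
          by_cases hik : i < k
          · refine hFS _ (hMF _ _) _ (ihm k.1 k j rfl ?_)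
            have : k ≠ b := by simpa using hk
            have : k.1 ≠ b.1 := fun h => this (Fin.ext h)
            rw [Fin.lt_def] at hik
            simp only [i] at hik
            lia
          · rw [hM, patternMatrix_eq_zero _ hik, zero_mul]
            exact S.zero_mem
        have h2 : ∑ k, N i k * M k j ∈ S := by
          refine S.sum_mem fun k hk => ?_
          by_cases hkj : k < j
          · rw [mul_comm]
            refine hFS _ (hMF _ _) _ (iha i k rfl ?_)
            rw [Fin.lt_def] at hkj
            simp only [i]
            lia
          · rw [hM, patternMatrix_eq_zero _ hkj, mul_zero]
            exact S.zero_mem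
        have hne : M i b ≠ 0 := by
          have : M i b = x (Sum.inl ⟨(i, b), hib⟩) := by simp [hM, patternMatrix, hib]
          rw [this]
          exact hreg _ hb.symm
        have h3 : N b j = (M i b)⁻¹ * (∑ k, N i k * M k j -
            ∑ k ∈ Finset.univ \ {b}, M i k * N k j) := by
          rw [eq_inv_mul_iff_mul_eq₀ hne]
          simp only [Matrix.zero_apply] at h0
          linear_combination h0
        rw [h3]
        exact hFS _ (F.inv_mem (hMF _ _)) _ (S.sub_mem h2 h1)
  have := hNS n p.1.1.1 p.1.1 p.1.2 rfl (by lia)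
  rwa [hN, patternMatrix_apply] at this

end recursion

/-! ### Large families of commuting matrices -/

section large
variable {n : ℕ} {R : Fin n → Fin n → Prop} [DecidableRel R] {K : Type*} [Field K] [IsAlgClosed K]

/-- Divide the indices into three blocks. For two block strictly upper triangular matrices, only the
upper right block of the commutator can be nonzero, so the commuting ones among them are cut out by
the vanishing of the entries off the block pattern and of that block. -/
theorem card_le_affineDim_commutingPairs (b : Fin n → Fin 3) :
    (Fintype.card (Pos R ⊕ Pos R) : WithBot ℕ∞) ≤ affineDim (commutingPairs R K) +
      ((2 * Fintype.card {p : Pos R // ¬ b p.1.1 < b p.1.2} +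
        Fintype.card {i // b i = 0} * Fintype.card {i // b i = 2} : ℕ) : WithBot ℕ∞) := by
  have h := card_le_affineDim_add_card (K := K) (V := commutingPairs R K)
    (E := ({p : Pos R // ¬ b p.1.1 < b p.1.2} ⊕ {p : Pos R // ¬ b p.1.1 < b p.1.2}) ⊕
      ({i // b i = 0} × {i // b i = 2}))
    (Sum.elim (Sum.elim (fun p => X (Sum.inl p.1)) (fun p => X (Sum.inr p.1)))
      (fun ij => commPoly R K ij.1 ij.2)) (fun x hx => ?_) 0 ?_
  · simpa only [Fintype.card_sum, Fintype.card_prod, ← two_mul] using h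
  · change pairComm R x = 0
    have h1 : ∀ i j, ¬ b i < b j → patternMatrix R (x ∘ Sum.inl) i j = 0 := by
      intro i j hij
      by_cases hR : R i j
      · simpa [patternMatrix, hR] using hx (Sum.inl (Sum.inl ⟨⟨(i, j), hR⟩, hij⟩))
      · exact patternMatrix_eq_zero _ hR
    have h2 : ∀ i j, ¬ b i < b j → patternMatrix R (x ∘ Sum.inr) i j = 0 := by
      intro i j hij
      by_cases hR : R i j
      · simpa [patternMatrix, hR] using hx (Sum.inl (Sum.inr ⟨⟨(i, j), hR⟩, hij⟩))
      · exact patternMatrix_eq_zero _ hR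
    ext i j
    by_cases hij : b i = 0 ∧ b j = 2
    · simpa [eval_commPoly] using hx (Sum.inr (⟨i, hij.1⟩, ⟨j, hij.2⟩))
    · rw [pairComm_apply]
      refine Finset.sum_eq_zero fun k _ => ?_
      have hk : ¬ b i < b k ∨ ¬ b k < b j := by
        by_contra! hcon
        exact hij ⟨by lia, by lia⟩
      rcases hk with hk | hk
      · rw [h1 i k hk, h2 i k hk]; simp
      · rw [h1 k j hk, h2 k j hk]; simp
  · rintro ((p | p) | ij)
    · simp
    · simp
    · rw [Sum.elim_inr, eval_commPoly]
      have : pairComm R (0 : Pos R ⊕ Pos R → K) = 0 := by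
        change patternMatrix R 0 * patternMatrix R 0 - patternMatrix R 0 * patternMatrix R 0 = 0
        simp
      rw [this]
      rfl
theorem not_affineDim_commutingPairs_le (b : Fin n → Fin 3) {d : ℕ}
    (hd : d + (2 * Fintype.card {p : Pos R // ¬ b p.1.1 < b p.1.2} +
        Fintype.card {i // b i = 0} * Fintype.card {i // b i = 2}) < 2 * Fintype.card (Pos R)) :
    ¬ affineDim (commutingPairs R K) ≤ (d : WithBot ℕ∞) := by
  intro h
  have h1 := (card_le_affineDim_commutingPairs (K := K) (R := R) b).trans (add_le_add h le_rfl)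
  rw [Fintype.card_sum, ← two_mul] at h1
  have h1 : 2 * Fintype.card (Pos R) ≤ d + (2 * Fintype.card {p : Pos R // ¬ b p.1.1 < b p.1.2} +
        Fintype.card {i // b i = 0} * Fintype.card {i // b i = 2}) := by exact_mod_cast h1
  lia

end large

/-- Blocks of sizes 8, 12 and 8. The block strictly upper triangular commuting pairs then form a
set of dimension at least `2 * (8 * 12 + 12 * 8) + 8 * 8 = 448`, while the expected dimensions for
size 28 are 434 (triangular) and 405 (strictly triangular). -/
def blockIndex (i : Fin 28) : Fin 3 := if i.1 < 8 then 0 else if i.1 < 20 then 1 else 2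

/-! ### Triangular and strictly triangular matrices -/

section triangular
variable {K : Type*} [Field K]

theorem pairComm_eq_zero_of_generic {n : ℕ} {R : Fin n → Fin n → Prop} [DecidableRel R]
    {L : Type*} [Field L] [Algebra K L]
    {x : Pos R ⊕ Pos R → L}
    (hx : ∀ f, aeval x f = 0 ↔ f ∈ vanishingIdeal K (commutingPairs R K)) :
    pairComm R x = 0 := by
  ext i j
  rw [← aeval_commPoly (K := K), Matrix.zero_apply, hx]
  intro y hy
  rw [aeval_commPoly, hy]
  rfl

theorem CT_eq (n : ℕ) : CT K n = commutingPairs (· ≤ ·) K := by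
  ext p
  exact sub_eq_zero.symm

theorem NT_eq (n : ℕ) : NT K n = commutingPairs (· < ·) K := by
  ext p
  exact sub_eq_zero.symm

section upper

theorem card_diag_add_card_lt (n : ℕ) :
    Fintype.card (Fin n) + Fintype.card {p : Fin n × Fin n // p.1 < p.2} =
      Fintype.card {p : Fin n × Fin n // p.1 ≤ p.2} := by
  rw [← Fintype.card_sum]
  refine Fintype.card_of_bijective (f := Sum.elim (fun i => ⟨(i, i), le_rfl⟩)
    (fun p => ⟨p.1, p.2.le⟩)) ⟨?_, ?_⟩
  · rintro (i | ⟨⟨i, j⟩, h⟩) (i' | ⟨⟨i', j'⟩, h'⟩) heq <;>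
      simp only [Sum.elim_inl, Sum.elim_inr, Subtype.mk.injEq, Prod.mk.injEq] at * <;> grind
  · rintro ⟨⟨i, j⟩, h⟩
    rcases eq_or_lt_of_le h with h' | h'
    · exact ⟨Sum.inl i, Subtype.ext (Prod.ext rfl h')⟩
    · exact ⟨Sum.inr ⟨(i, j), h'⟩, rfl⟩

theorem pairComm_le_eq_zero {n : ℕ} {A : Type*} [CommRing A]
    (x : Pos (n := n) (· ≤ ·) ⊕ Pos (n := n) (· ≤ ·) → A) (i j : Fin n) (h : ¬ i < j) :
    pairComm _ x i j = 0 := by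
  rw [pairComm_apply]
  refine Finset.sum_eq_zero fun k _ => ?_
  by_cases hik : i ≤ k
  · by_cases hkj : k ≤ j
    · obtain rfl : i = k := by order
      obtain rfl : i = j := by order
      ring
    · rw [patternMatrix_eq_zero _ hkj, patternMatrix_eq_zero _ hkj]
      ring
  · rw [patternMatrix_eq_zero _ hik, patternMatrix_eq_zero _ hik]
    ring

/-- The entries of the diagonal matrix with diagonal `c`. -/
def diagEntries {n : ℕ} (c : Fin n → K) (p : Pos (n := n) (· ≤ ·)) : K :=
  if p.1.1 = p.1.2 then c p.1.1 else 0

theorem isConeSystem_CT {n : ℕ} {c : Fin n → K} (hc : Function.Injective c) :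
    IsConeSystem (CT K n)
      (fun p : {p : Fin n × Fin n // p.1 < p.2} => commPoly (· ≤ ·) K p.1.1 p.1.2)
      (Sum.elim (fun e => X (Sum.inl e) - C (diagEntries c e))
        (fun i => X (Sum.inr ⟨(i, i), le_rfl⟩)))
      (Sum.elim (diagEntries c) 0) := by
  rw [CT_eq]
  refine isConeSystem_commutingPairs (E := (· < ·)) (R := (· ≤ ·))
    (fun i : Fin n => ⟨(i, i), le_rfl⟩) pairComm_le_eq_zero
    (fun i j h => ⟨h.ne, i, le_rfl, h.le⟩) (card_diag_add_card_lt n) _ fun y hy hd => ?_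
  funext p
  refine patternMatrix_mem_of_commute_le ⊤ ⊥ (fun a _ b hb => ?_) _ hy (fun _ => trivial)
    (fun i j hij => ?_) (fun i => ?_) p
  · rw [AddSubgroup.mem_bot] at *
    rw [hb, mul_zero]
  · simpa [diagEntries] using hc.ne hij
  · exact hd i

/-- The coordinates that generate the function field are the entries of the first matrix and the
diagonal of the second one. -/
theorem affineDim_CT_le [Infinite K] {n : ℕ} (h : ZariskiIrreducible (CT K n)) :
    affineDim (CT K n) ≤
      (Fintype.card ({p : Fin n × Fin n // p.1 ≤ p.2} ⊕ Fin n) : WithBot ℕ∞) := by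
  rw [CT_eq] at h ⊢
  refine h.affineDim_le (Sum.map id fun i => ⟨(i, i), le_rfl⟩) fun L _ _ x hx F hz s => ?_
  rcases s with p | p
  · exact hz (Sum.inl p)
  refine patternMatrix_mem_of_commute_le F.toSubfield F.toSubfield.toAddSubgroup
    (fun a ha b hb => F.mul_mem ha hb) x (pairComm_eq_zero_of_generic hx)
    (fun p => hz (Sum.inl p)) (fun i j hij heq => ?_) (fun i => hz (Sum.inr i)) p
  -- `(diag c, 0)` is a point at which the diagonal entries of the first matrix differ
  let c : Fin n → K := fun i => Infinite.natEmbedding K i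
  have hc : c i - c j ≠ 0 := sub_ne_zero.2 fun h => hij (Fin.ext ((Infinite.natEmbedding K).injective h))
  apply hc
  have := (hx (X (Sum.inl ⟨(i, i), le_rfl⟩) - X (Sum.inl ⟨(j, j), le_rfl⟩))).1
    (by simpa [sub_eq_zero] using heq) _ (elim_zero_mem_commutingPairs (diagEntries c))
  simpa [diagEntries] using this

end upper

section strict

/-- The equation at `(i, j)` corresponds to the entry at `(i + 1, j)`. -/
theorem card_firstRow_add_card (n : ℕ) :
    Fintype.card {p : Pos (n := n) (· < ·) // p.1.1.1 = 0} +
      Fintype.card {p : Fin n × Fin n // p.1.1 + 1 < p.2.1} =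
      Fintype.card {p : Fin n × Fin n // p.1 < p.2} := by
  rw [← Fintype.card_sum]
  refine Fintype.card_of_bijective (f := Sum.elim Subtype.val
    (fun p => ⟨(⟨p.1.1.1 + 1, by lia⟩, p.1.2), p.2⟩)) ⟨?_, ?_⟩
  · rintro (⟨⟨⟨i, j⟩, h⟩, h₀⟩ | ⟨⟨i, j⟩, h⟩) (⟨⟨⟨i', j'⟩, h'⟩, h₀'⟩ | ⟨⟨i', j'⟩, h'⟩) heq <;>
      simp only [Sum.elim_inl, Sum.elim_inr, Subtype.mk.injEq, Prod.mk.injEq, Fin.ext_iff] at * <;>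
      grind
  · rintro ⟨⟨i, j⟩, h⟩
    by_cases h₀ : i.1 = 0
    · exact ⟨Sum.inl ⟨⟨(i, j), h⟩, h₀⟩, rfl⟩
    · have h' : i.1 < j.1 := h
      refine ⟨Sum.inr ⟨(⟨i.1 - 1, by lia⟩, j), ?_⟩, ?_⟩
      · simp only
        lia
      · simp only [Sum.elim_inr, Subtype.mk.injEq, Prod.mk.injEq, Fin.ext_iff, and_true]
        lia

theorem pairComm_lt_eq_zero {n : ℕ} {A : Type*} [CommRing A]
    (x : Pos (n := n) (· < ·) ⊕ Pos (n := n) (· < ·) → A) (i j : Fin n) (h : ¬ i.1 + 1 < j.1) :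
    pairComm _ x i j = 0 := by
  rw [pairComm_apply]
  refine Finset.sum_eq_zero fun k _ => ?_
  by_cases hik : i < k
  · have hkj : ¬ k < j := by
      rw [Fin.lt_def] at *
      lia
    rw [patternMatrix_eq_zero _ hkj, patternMatrix_eq_zero _ hkj]
    ring
  · rw [patternMatrix_eq_zero _ hik, patternMatrix_eq_zero _ hik]
    ring

/-- The entries of the nilpotent Jordan block. -/
def jordanEntries (K : Type*) [Field K] {n : ℕ} (p : Pos (n := n) (· < ·)) : K :=
  if p.1.1.1 + 1 = p.1.2.1 then 1 else 0

theorem isConeSystem_NT (n : ℕ) :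
    IsConeSystem (NT K n)
      (fun p : {p : Fin n × Fin n // p.1.1 + 1 < p.2.1} => commPoly (· < ·) K p.1.1 p.1.2)
      (Sum.elim (fun e => X (Sum.inl e) - C (jordanEntries K e))
        (fun d : {p : Pos (n := n) (· < ·) // p.1.1.1 = 0} => X (Sum.inr d.1)))
      (Sum.elim (jordanEntries K) 0) := by
  rw [NT_eq]
  refine isConeSystem_commutingPairs (E := fun i j => i.1 + 1 < j.1) (R := (· < ·))
    (D := {p : Pos (n := n) (· < ·) // p.1.1.1 = 0})
    Subtype.val pairComm_lt_eq_zero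
    (fun i j h => ⟨fun h' => by subst h'; lia, ⟨i.1 + 1, by lia⟩, ?_, h⟩)
    (card_firstRow_add_card n) _ fun y hy hd => ?_
  · rw [Fin.lt_def]
    simp
  funext p
  refine patternMatrix_mem_of_commute_lt ⊤ ⊥ (fun a _ b hb => ?_) _ hy (fun _ => trivial)
    (fun p hp => ?_) (fun p hp => ?_) p
  · rw [AddSubgroup.mem_bot] at *
    rw [hb, mul_zero]
  · simp [jordanEntries, hp]
  · exact hd ⟨p, hp⟩

/-- The coordinates that generate the function field are the entries of the first matrix and the
first row of the second one. -/
theorem affineDim_NT_le {n : ℕ} (h : ZariskiIrreducible (NT K n)) :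
    affineDim (NT K n) ≤ (Fintype.card ({p : Fin n × Fin n // p.1 < p.2} ⊕
      {p : Pos (n := n) (· < ·) // p.1.1.1 = 0}) : WithBot ℕ∞) := by
  rw [NT_eq] at h ⊢
  refine h.affineDim_le (Sum.map id Subtype.val) fun L _ _ x hx F hz s => ?_
  rcases s with p | p
  · exact hz (Sum.inl p)
  refine patternMatrix_mem_of_commute_lt F.toSubfield F.toSubfield.toAddSubgroup
    (fun a ha b hb => F.mul_mem ha hb) x (pairComm_eq_zero_of_generic hx)
    (fun p => hz (Sum.inl p)) (fun p hp heq => ?_) (fun p hp => hz (Sum.inr ⟨p, hp⟩)) p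
  have := (hx (X (Sum.inl p))).1 (by simpa using heq) _
    (elim_zero_mem_commutingPairs (jordanEntries K))
  simp [jordanEntries, hp] at this

end strict

end triangular

/-! ### Thresholds -/

theorem exists_threshold {P : ℕ → Prop} (h0 : P 0) (hs : ∀ n, 1 ≤ n → ¬ P (n - 1) → ¬ P n)
    {N : ℕ} (hN : ¬ P N) : ∃ m, ∀ n, ¬ P n ↔ m < n := by
  have hmono : ∀ k n, ¬ P k → k ≤ n → ¬ P n := fun k n hk hkn => by
    induction n, hkn using Nat.le_induction with
    | base => exact hk
    | succ n _ ih => exact hs (n + 1) (by lia) ih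
  classical
  have hex : ∃ n, ¬ P n := ⟨N, hN⟩
  have hpos : Nat.find hex ≠ 0 := fun h => (h ▸ Nat.find_spec hex) h0
  refine ⟨Nat.find hex - 1, fun n => ⟨fun hn => ?_, fun hn => ?_⟩⟩
  · have := Nat.find_min' hex hn
    lia
  · exact hmono _ n (Nat.find_spec hex) (by lia)

/-- The conclusions for a sequence of cone systems, each extending the previous one, that starts
with a point and whose dimension exceeds the expected one at some stage `N`. -/
theorem exists_thresholds {K : Type*} [Field K] [IsAlgClosed K] (σ : ℕ → Type)
    (E D : ℕ → Type) [∀ n, Fintype (σ n)] [∀ n, Fintype (E n)] [∀ n, Fintype (D n)] (V : ∀ n, Set (σ n → K))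
    (q : ∀ n, E n → MvPolynomial (σ n) K) (h : ∀ n, D n → MvPolynomial (σ n) K)
    (v : ∀ n, σ n → K) (H : ∀ n, IsConeSystem (V n) (q n) (h n) (v n))
    (ι : ∀ n, σ n ↪ σ (n + 1)) (j : ∀ n, E n ↪ E (n + 1))
    (X : ∀ n, IsExtension (q (n + 1)) (q n) (ι n) (j n))
    (h0 : IsEmpty (σ 0))
    (hirr : ∀ n, ZariskiIrreducible (V n) → affineDim (V n) ≤ (Fintype.card (D n) : WithBot ℕ∞))
    (N : ℕ) (hN : ¬ affineDim (V N) ≤ (Fintype.card (D N) : WithBot ℕ∞)) :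
    (∀ n : ℕ, 1 ≤ n →
      (¬ ZariskiIrreducible (V (n - 1)) → ¬ ZariskiIrreducible (V n)) ∧
      (¬ IsSetCompleteIntersection (V (n - 1)) → ¬ IsSetCompleteIntersection (V n)) ∧
      (¬ IsIdealCompleteIntersection (V (n - 1)) → ¬ IsIdealCompleteIntersection (V n))) ∧
    (∃ m : ℕ, ∀ n : ℕ, ¬ IsSetCompleteIntersection (V n) ↔ m < n) ∧
    (∃ m : ℕ, ∀ n : ℕ, ¬ IsIdealCompleteIntersection (V n) ↔ m < n) ∧
    (∃ m' : ℕ, ∀ n : ℕ, ¬ ZariskiIrreducible (V n) ↔ m' < n) := by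
  have hstep : ∀ n : ℕ, 1 ≤ n →
      (¬ ZariskiIrreducible (V (n - 1)) → ¬ ZariskiIrreducible (V n)) ∧
      (¬ IsSetCompleteIntersection (V (n - 1)) → ¬ IsSetCompleteIntersection (V n)) ∧
      (¬ IsIdealCompleteIntersection (V (n - 1)) → ¬ IsIdealCompleteIntersection (V n)) := by
    intro n hn
    obtain ⟨n, rfl⟩ := Nat.exists_eq_add_of_le' hn
    exact (X n).step (H (n + 1)) (H n)
  have hdim0 : affineDim (V 0) ≤ (Fintype.card (D 0) : WithBot ℕ∞) := by
    refine (affineDim_le_card _).trans ?_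
    rw [Fintype.card_eq_zero]
    exact_mod_cast Nat.zero_le _
  have hE0 : IsEmpty (E 0) := by
    rw [← Fintype.card_eq_zero_iff]
    have := (H 0).card_add_card
    rw [Fintype.card_eq_zero (α := σ 0)] at this
    lia
  have hI0 : vanishingIdeal K (V 0) = Ideal.span (Set.range (q 0)) := by
    rw [Set.range_eq_empty, Ideal.span_empty, eq_bot_iff]
    intro f hf
    have := hf 0 (H 0).zero_mem
    rw [MvPolynomial.eq_C_of_isEmpty f] at this ⊢
    simpa using this
  refine ⟨hstep, exists_threshold ?_ (fun n hn => (hstep n hn).2.1) (N := N) ?_,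
    exists_threshold ?_ (fun n hn => (hstep n hn).2.2) (N := N) ?_,
    exists_threshold ?_ (fun n hn => (hstep n hn).1) (N := N) (mt (hirr N) hN)⟩
  · exact (H 0).isSetCompleteIntersection_iff.2 hdim0
  · rwa [(H N).isSetCompleteIntersection_iff]
  · exact (H 0).isIdealCompleteIntersection_iff.2 ⟨hdim0, hI0⟩
  · rw [(H N).isIdealCompleteIntersection_iff]
    exact fun h => hN h.1
  · refine ⟨⟨0, (H 0).zero_mem⟩, fun I J hIJ => ?_⟩
    have : ∀ x ∈ V 0, x = 0 := fun x _ => Subsingleton.elim _ _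
    exact (hIJ (H 0).zero_mem).imp (fun h x hx => this x hx ▸ h) (fun h x hx => this x hx ▸ h)

end CommutingTriangular

theorem proposition3 (K : Type*) [Field K] [IsAlgClosed K] :
    -- the step for upper triangular matrices
    (∀ n : ℕ, 1 ≤ n →
      (¬ ZariskiIrreducible (CT K (n - 1)) → ¬ ZariskiIrreducible (CT K n)) ∧
      (¬ IsSetCompleteIntersection (CT K (n - 1)) → ¬ IsSetCompleteIntersection (CT K n)) ∧
      (¬ IsIdealCompleteIntersection (CT K (n - 1)) → ¬ IsIdealCompleteIntersection (CT K n))) ∧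
    -- the step for strictly upper triangular matrices
    (∀ n : ℕ, 1 ≤ n →
      (¬ ZariskiIrreducible (NT K (n - 1)) → ¬ ZariskiIrreducible (NT K n)) ∧
      (¬ IsSetCompleteIntersection (NT K (n - 1)) → ¬ IsSetCompleteIntersection (NT K n)) ∧
      (¬ IsIdealCompleteIntersection (NT K (n - 1)) → ¬ IsIdealCompleteIntersection (NT K n))) ∧
    -- the thresholds for upper triangular matrices
    (∃ m : ℕ, ∀ n : ℕ, ¬ IsSetCompleteIntersection (CT K n) ↔ m < n) ∧
    (∃ m : ℕ, ∀ n : ℕ, ¬ IsIdealCompleteIntersection (CT K n) ↔ m < n) ∧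
    (∃ m' : ℕ, ∀ n : ℕ, ¬ ZariskiIrreducible (CT K n) ↔ m' < n) ∧
    -- the thresholds for strictly upper triangular matrices
    (∃ m : ℕ, ∀ n : ℕ, ¬ IsSetCompleteIntersection (NT K n) ↔ m < n) ∧
    (∃ m : ℕ, ∀ n : ℕ, ¬ IsIdealCompleteIntersection (NT K n) ↔ m < n) ∧
    (∃ m' : ℕ, ∀ n : ℕ, ¬ ZariskiIrreducible (NT K n) ↔ m' < n) := by
  have hCT := exists_thresholds (K := K) _ _ _ (CT K) _ _ _
    (fun n => isConeSystem_CT (n := n) (c := fun i => Infinite.natEmbedding K i)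
      fun i j h => Fin.ext ((Infinite.natEmbedding K).injective h)) _ _
    (fun n => isExtension_castSucc (R := (· ≤ ·)) (E := (· < ·)) (R' := (· ≤ ·)) (E' := (· < ·))
      (fun i j => Fin.castSucc_le_castSucc_iff) (fun i j => Fin.castSucc_lt_castSucc_iff)
      (fun j => (Fin.castSucc_lt_last j).not_ge))
    ⟨fun s => s.elim (fun p => p.1.1.elim0) (fun p => p.1.1.elim0)⟩
    (fun n => affineDim_CT_le) 28 (by
      rw [CT_eq]
      exact not_affineDim_commutingPairs_le blockIndex (by decide +kernel))
  have hNT := exists_thresholds (K := K) _ _ _ (NT K) _ _ _ isConeSystem_NT _ _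
    (fun n => isExtension_castSucc (R := (· < ·)) (E := fun i j => i.1 + 1 < j.1)
      (R' := (· < ·)) (E' := fun i j => i.1 + 1 < j.1)
      (fun i j => Fin.castSucc_lt_castSucc_iff) (fun i j => Iff.rfl)
      (fun j => (Fin.castSucc_lt_last j).asymm))
    ⟨fun s => s.elim (fun p => p.1.1.elim0) (fun p => p.1.1.elim0)⟩
    (fun n => affineDim_NT_le) 28 (by
      rw [NT_eq]
      exact not_affineDim_commutingPairs_le blockIndex (by decide +kernel))
  exact ⟨hCT.1, hNT.1, hCT.2.1, hCT.2.2.1, hCT.2.2.2, hNT.2.1, hNT.2.2.1, hNT.2.2.2⟩
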